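/- Let $k,l,a,b$ be non-negative integers with $l\le k$ and $a+b\le l$. Put $A_{m,m'}=2\min(m,m')+\max(m+m'-k,0)$. **Configurations.** Let $C^{(k,l)}$ be the set of finitely supported sequences $\mathbf a=(a_i)_{i\in\mathbb Z}$ of non-negative integers such that for all $i$ $$a_i+a_{i+1}+a_{i+2}\le k,\qquad a_i+a_{i+1}\le l,\qquad a_{i-1}+2a_i+2a_{i+1}+a_{i+2}\le k+l,$$ and let $C^{(k,l)}_{a,b}$ be the set of those $\mathbf a\in C^{(k,l)}$ with $a_i=0$ for $i<0$, $a_0=a$, $a_1=b$. The weight of $\mathbf a\in C^{(k,k)}$ is the least $m$ with $\mathbf a\in C^{(k,m)}$. For $\mathbf a\neq0$ of weight $m$, let $i_1$ be the largest $i$ with $a_i+a_{i+1}=m$ or $a_{i-1}+2a_i+2a_{i+1}+a_{i+2}=k+m$; the right move $M_+\mathbf a$ is obtained from $\mathbf a$ by replacing $a_{i_1}$ by $a_{i_1}-1$ and $a_{i_1+1}$ by $a_{i_1+1}+1$; it again has weight $m$. **Rigged partitions.** A rigged partition is a pair $(\lambda,\rho)$ with $\lambda_1\ge\dots\ge\lambda_n>0$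 integers ($n\ge0$), $\rho\in\mathbb Z^n$, and $\rho_i\ge\rho_{i+1}$ whenever $\lambda_i=\lambda_{i+1}$. Let $R^{(l)}$ be the set of rigged partitions with all $\lambda_i\le l$, and for $\mathbf r=(r_1,\dots,r_l)\in\mathbb Z_{\ge0}^l$ let $R^{(l)}(\mathbf r)=\{(\lambda,\rho)\in R^{(l)}:\rho_i\ge r_{\lambda_i}\text{ for all }i\}$. The character of $R\subset R^{(k)}$ is the formal power series $$\chi(R)=\sum_{(\lambda,\rho)\in R}q^{d(\lambda,\rho)},\qquad d(\lambda,\rho)=\sum_{i<j}A_{\lambda_i,\lambda_j}+\sum_i\rho_i .$$ **The map $\iota$.** Define $\iota:C^{(k,k)}\to R^{(k)}$ by induction on $\sum_i a_i$. Set $\iota(\mathbf 0)=\emptyset$. If $\mathbf a\ne0$ has weight $m$, let $i_0-1$ be the largest index with $a_{i_0-1}\neq 0$, let $t_0\ge0$ be the least $t$ such that $(M_+^{t+1}\mathbf a)_{i_0}\ne0$, put $\mathbf b=M_+^{t_0}\mathbf a$, and $s=(i_0-1)b_{i_0-1}+i_0b_{i_0}-t_0$. Let $\overline{\mathbf a}$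 agree with $\mathbf b$ at indices $\le i_0-2$ and be $0$ elsewhere, and write $\iota(\overline{\mathbf a})=((\lambda_2,\dots,\lambda_n),(\rho_2,\dots,\rho_n))$. Then $\iota(\mathbf a)=((\lambda_1,\dots,\lambda_n),(\rho_1,\dots,\rho_n))$ with $\lambda_1=m$ and $\rho_1=s-\sum_{j=2}^nA_{\lambda_1,\lambda_j}$. **Statement.** Let $[a,b]_l=\iota(C^{(k,l)}_{a,b})$. Then $[a,b]_l$ and all the sets $R^{(l)}(\mathbf r)$ are subsets of $R^{(k)}$ with non-negative degrees and finitely many elements of each degree, so that their characters are well-defined formal power series, and $$\begin{aligned}\chi([a,b]_l)={}&\chi\bigl(R^{(l)}(\underbrace{0,\dots,0}_a,\underbrace{1,\dots,b}_b,\underbrace{b+2,b+4,\dots,2l-2a-b}_{l-a-b})\bigr)\\ &-\chi\bigl(R^{(l)}(\underbrace{0,\dots,0}_{a-1},1,\underbrace{2,\dots,b+1}_b,\underbrace{b+2,b+4,\dots,2l-2a-b}_{l-a-b})\bigr)\\ &-\chi\bigl(R^{(l)}(\underbrace{0,\dots,0}_a,\underbrace{1,\dots,b-1}_{b-1},b+1,\underbrace{b+3,b+5,\dots,2l-2a-b+1}_{l-a-b})\bigr)\\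 &+\chi\bigl(R^{(l)}(\underbrace{0,\dots,0}_{a-1},1,\underbrace{2,\dots,b}_{b-1},b+1,\underbrace{b+3,b+5,\dots,2l-2a-b+1}_{l-a-b})\bigr),\end{aligned}$$ where a term containing a block of length $-1$ is understood as $0$ (that is, the second term is $0$ if $a=0$, the third if $b=0$, and the fourth if $a=0$ or $b=0$), and the entries in each last block increase in steps of $2$. Moreover, if $a+b=l$ and $a\neq l$, then the second and the fourth term cancel each other; if $a=l\geq 1$, they do not. -/

import Mathlib

/-- A finite configuration: a finitely supported sequence `(a_i)` of non-negative integers,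
indexed by the integers. -/
abbrev Config := ℤ →₀ ℕ

namespace Config

/-- The length `|a| = ∑ a_i`. -/
def length (a : Config) : ℕ := a.sum fun _ n => n

/-- `S[i, a] = a_i + a_{i+1}`. -/
def S (a : Config) (i : ℤ) : ℕ := a i + a (i + 1)

/-- `L[i, a] = a_{i-1} + 2 a_i + 2 a_{i+1} + a_{i+2}`. -/
def L (a : Config) (i : ℤ) : ℕ := a (i - 1) + 2 * a i + 2 * a (i + 1) + a (i + 2)

/-- The set `C^{(k,l)}` of finite `(k,3)`-admissible configurations satisfying the
conditions of maximal weight at most `l`. -/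
def admissible (k l : ℕ) : Set Config :=
  {a | (∀ i, a i + a (i + 1) + a (i + 2) ≤ k) ∧ (∀ i, a.S i ≤ l) ∧ (∀ i, a.L i ≤ k + l)}

/-- The set `C^{(k,l)}_{a,b}` of positively supported elements `c` of `C^{(k,l)}` with
`c_0 = a` and `c_1 = b`. -/
def initial (k l a b : ℕ) : Set Config :=
  {c | c ∈ admissible k l ∧ (∀ i < 0, c i = 0) ∧ c 0 = a ∧ c 1 = b}

/-- The `l` with `a ∈ C^{(k,l)} \ C^{(k,l-1)}` (for `(k,3)`-admissible `a`). -/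
noncomputable def weight (k : ℕ) (a : Config) : ℕ := sInf {l | a ∈ admissible k l}

/-- The highest position of a particle of weight `l`: the largest `i` with `S[i, a] = l` or
`L[i, a] = k + l`. -/
noncomputable def highestPos (k l : ℕ) (a : Config) : ℤ :=
  sSup {i | a.S i = l ∨ a.L i = k + l}

/-- The right move `M_+`: with `i` the highest position of a particle of weight `l`, decrease
`a_i` by one and increase `a_{i+1}` by one. -/
noncomputable def rightMove (k l : ℕ) (a : Config) : Config :=
  a - Finsupp.single (highestPos k l a) 1 + Finsupp.single (highestPos k l a + 1) 1

/-- The largest `i` with `a_i ≠ 0` (for `a ≠ 0`); this is `i_0 - 1`. -/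
noncomputable def top (a : Config) : ℤ := sSup {i | a i ≠ 0}

/-- The time `t_0`: the support of `a` first extends beyond `top a` in the move from
`M_+^{t_0} a` to `M_+^{t_0 + 1} a`. -/
noncomputable def freeTime (k l : ℕ) (a : Config) : ℕ :=
  sInf {t | (rightMove k l)^[t + 1] a (top a + 1) ≠ 0}

/-- The configuration `M_+^{t_0} a`. In it the particle of weight `l` of highest position is
free, and it sits at the position `top a`. -/
noncomputable def freed (k l : ℕ) (a : Config) : Config := (rightMove k l)^[freeTime k l a] a

/-- The number `s = d - t_0`, where `d` is the energy of the free particle of `M_+^{t_0} a`. -/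
noncomputable def shiftedEnergy (k l : ℕ) (a : Config) : ℤ :=
  top a * (freed k l a (top a) : ℤ) + (top a + 1) * (freed k l a (top a + 1) : ℤ)
    - (freeTime k l a : ℤ)

/-- The configuration `M_+^{t_0} a` with its free particle removed. -/
noncomputable def removeFree (k l : ℕ) (a : Config) : Config :=
  (freed k l a).filter fun i => i < top a

end Config

/-- `A_{l,m} = 2 min(l, m) + max(l + m - k, 0)` (the subtraction of natural numbers is
truncated, so it is the positive part). -/
def phaseShift (k l m : ℕ) : ℕ := 2 * min l m + (l + m - k)

/-- Data `((λ_1, ρ_1), …, (λ_n, ρ_n))` of a partition and an integer rigging. -/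
abbrev RiggedData := List (ℕ × ℤ)

/-- The set `R^{(l)}` of rigged partitions with parts at most `l`: `l ≥ λ_1 ≥ … ≥ λ_n > 0`,
and `ρ_i ≥ ρ_j` for `i < j` with `λ_i = λ_j`. -/
def riggedPartitions (l : ℕ) : Set RiggedData :=
  {p | (∀ x ∈ p, 0 < x.1 ∧ x.1 ≤ l) ∧
    p.Pairwise fun x y => y.1 ≤ x.1 ∧ (x.1 = y.1 → y.2 ≤ x.2)}

/-- The set `R^{(l)}(r_1, …, r_l)` of rigged partitions in `R^{(l)}` with `ρ_i ≥ r_{λ_i}`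
for all `i`; the vector `r` is given as a list of length `l`. -/
def restrictedRigged (l : ℕ) (r : List ℕ) : Set RiggedData :=
  {p | p ∈ riggedPartitions l ∧ ∀ x ∈ p, (r.getD (x.1 - 1) 0 : ℤ) ≤ x.2}

/-- The degree `d(λ, ρ) = ∑_{i < j} A_{λ_i, λ_j} + ∑_i ρ_i`. -/
def riggedDegree (k : ℕ) : RiggedData → ℤ
  | [] => 0
  | x :: p => x.2 + (p.map fun y => (phaseShift k x.1 y.1 : ℤ)).sum + riggedDegree k p

/-- Particle content and rigging of a configuration of length at most the first explicit
natural number, by recursion: each removed particle has weight at least one, so the length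
strictly decreases. -/
noncomputable def contentAux (k : ℕ) : ℕ → Config → RiggedData
  | 0, _ => []
  | n + 1, a =>
    open scoped Classical in
    if a = 0 then [] else
      let l := a.weight k
      let rest := contentAux k n (a.removeFree k l)
      (l, a.shiftedEnergy k l - (rest.map fun y => (phaseShift k l y.1 : ℤ)).sum) :: rest

/-- The map `ι` sending a configuration to its particle content and rigging. -/
noncomputable def content (k : ℕ) (a : Config) : RiggedData := contentAux k a.length a

/-- The set `[a, b]_l`, the image of `C^{(k,l)}_{a,b}` under `ι`. -/
noncomputable def initialImage (k l a b : ℕ) : Set RiggedData :=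
  content k '' Config.initial k l a b

/-- The character `χ(R) = ∑_{(λ,ρ) ∈ R} q^{d(λ,ρ)}`, a formal power series in `q`. -/
noncomputable def character (k : ℕ) (R : Set RiggedData) : PowerSeries ℤ :=
  PowerSeries.mk fun n => (({p | p ∈ R ∧ riggedDegree k p = n} : Set RiggedData).ncard : ℤ)

/-- `R` is a set of rigged partitions in `R^{(k)}` whose character is a well-defined formal
power series: degrees are non-negative and each degree occurs finitely often. -/
def HasCharacter (k : ℕ) (R : Set RiggedData) : Prop :=
  R ⊆ riggedPartitions k ∧ (∀ p ∈ R, 0 ≤ riggedDegree k p) ∧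
    ∀ n : ℤ, {p | p ∈ R ∧ riggedDegree k p = n}.Finite

/-- `χ(R^{(l)}(0^a, 1, …, b, b+2, b+4, …, 2l-2a-b))`. -/
noncomputable def firstTerm (k l a b : ℕ) : PowerSeries ℤ :=
  character k (restrictedRigged l
    (List.replicate a 0 ++ List.range' 1 b ++ List.range' (b + 2) (l - a - b) 2))

/-- `χ(R^{(l)}(0^{a-1}, 1, 2, …, b+1, b+2, b+4, …, 2l-2a-b))`, zero if `a = 0`. -/
noncomputable def secondTerm (k l a b : ℕ) : PowerSeries ℤ :=
  if a = 0 then 0 else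
  character k (restrictedRigged l
    (List.replicate (a - 1) 0 ++ [1] ++ List.range' 2 b ++ List.range' (b + 2) (l - a - b) 2))

/-- `χ(R^{(l)}(0^a, 1, …, b-1, b+1, b+3, b+5, …, 2l-2a-b+1))`, zero if `b = 0`. -/
noncomputable def thirdTerm (k l a b : ℕ) : PowerSeries ℤ :=
  if b = 0 then 0 else
  character k (restrictedRigged l
    (List.replicate a 0 ++ List.range' 1 (b - 1) ++ [b + 1] ++
      List.range' (b + 3) (l - a - b) 2))

/-- `χ(R^{(l)}(0^{a-1}, 1, 2, …, b, b+1, b+3, b+5, …, 2l-2a-b+1))`, zero if `a = 0` or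
`b = 0`. -/
noncomputable def fourthTerm (k l a b : ℕ) : PowerSeries ℤ :=
  if a = 0 ∨ b = 0 then 0 else
  character k (restrictedRigged l
    (List.replicate (a - 1) 0 ++ [1] ++ List.range' 2 (b - 1) ++ [b + 1] ++
      List.range' (b + 3) (l - a - b) 2))

/-! Everything rests on one auxiliary function. For a configuration and a test weight m, the profile
Q (`IsProfile`) solves a min-plus recurrence driven by the slacks m − S and k + m − L, and equals
m(j + 1) far to the left. Call min(Q_i, Q_{i+1}) the level at i. On C^{(k,m)} levels increase weakly
with i (`IsProfile.level_mono`), and they do not change across a position of a particle of weight m.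

Three facts link profiles to the dynamics. A right move of weight m raises the level of the highest
particle by exactly one (`IsProfile.level_highest_move`). A right move of weight n ≤ m does not
change the profile from three sites past it onwards (`IsProfile.move_eq_of_gt`). A free particle of
weight n ≤ m lowers the profile on its right by A_{m,n} (`IsProfile.free_eq_of_gt`). Hence Q_j = m(j
+ 1) − ∑ A_{m,λ_i} far to the right, and ρ_1 is simply the level at the highest position
(`content_eq_cons`): the rigging is read off without running the dynamics.

Monotonicity of levels orders the riggings of equal parts, and the explicit profile at the left end
turns boundary values into inequalities on riggings (`content_hasBoundary`). Conversely, every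
rigged partition occurs: place a free particle far to the right and undo right moves until its level
is the wanted rigging, which is possible while that level exceeds the one of the next particle of
equal weight (`HasWeight.exists_rightMove_eq`).

So [a, b]_l consists of the rigged partitions with parts at most l and ρ ≥ max(0, λ − a, 2λ − 2a −
b), where the value λ − a is attained if a > 0 and 2λ − 2a − b is attained if b > 0
(`initialImage_eq`). Inclusion–exclusion over the two attainment conditions gives the four terms.
Injectivity of ι plays no role, since the character counts elements of the image. -/

namespace Config

/-! ### Local effect of moving one unit to the right -/

theorem L_eq_S (a : Config) (i : ℤ) : a.L i = a.S (i - 1) + a.S i + a.S (i + 1) := by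
  simp only [L, S, show i - 1 + 1 = i by ring, show i + 1 + 1 = i + 2 by ring]
  ring

theorem exists_forall_lt_eq_zero (a : Config) : ∃ z, ∀ i < z, a i = 0 := by
  obtain ⟨z, hz⟩ := a.support.finite_toSet.bddBelow
  exact ⟨z, fun i hi => by_contra fun h => absurd (hz (Finsupp.mem_support_iff.2 h)) (by omega)⟩

theorem exists_forall_gt_eq_zero (a : Config) : ∃ z, ∀ i > z, a i = 0 := by
  obtain ⟨z, hz⟩ := a.support.finite_toSet.bddAbove
  exact ⟨z, fun i hi => by_contra fun h => absurd (hz (Finsupp.mem_support_iff.2 h)) (by omega)⟩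

theorem S_congr {a b : Config} {i : ℤ} (h : a i = b i) (h' : a (i + 1) = b (i + 1)) :
    a.S i = b.S i := by
  rw [S, S, h, h']

/-- `i` is the position of a particle of weight `m`. -/
def IsPos (k m : ℕ) (a : Config) (i : ℤ) : Prop := a.S i = m ∨ a.L i = k + m

/-- `h` is the highest position of a particle of weight `m`. -/
def IsHighest (k m : ℕ) (a : Config) (h : ℤ) : Prop :=
  IsPos k m a h ∧ ∀ i > h, ¬ IsPos k m a i

/-- `a` is an admissible configuration of positive weight `m`. -/
def HasWeight (k m : ℕ) (a : Config) : Prop :=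
  a ∈ admissible k m ∧ (∃ i, IsPos k m a i) ∧ 0 < m ∧ m ≤ k

/-- Move one unit from the site `h` to the site `h + 1`. -/
noncomputable def move (a : Config) (h : ℤ) : Config :=
  a - Finsupp.single h 1 + Finsupp.single (h + 1) 1

theorem rightMove_eq (k m : ℕ) (a : Config) : rightMove k m a = a.move (highestPos k m a) := rfl

section move
variable {a : Config} {h : ℤ}

theorem move_apply_of_ne (i : ℤ) (h1 : i ≠ h) (h2 : i ≠ h + 1) : a.move h i = a i := by
  simp [move, h1.symm, h2.symm]

theorem move_apply_self : a.move h h = a h - 1 := by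
  simp [move]

theorem move_apply_succ : a.move h (h + 1) = a (h + 1) + 1 := by
  simp [move]

theorem S_move_of_ne (i : ℤ) (ha : 0 < a h) (h1 : i ≠ h - 1) (h2 : i ≠ h + 1) :
    (a.move h).S i = a.S i := by
  unfold S
  by_cases h3 : i = h
  · subst h3
    rw [move_apply_self, move_apply_succ]
    omega
  · rw [move_apply_of_ne i h3 h2, move_apply_of_ne (i + 1) (by omega) (by omega)]

theorem S_move_pred (ha : 0 < a h) : (a.move h).S (h - 1) + 1 = a.S (h - 1) := by
  unfold S
  rw [move_apply_of_ne (h - 1) (by omega) (by omega), show h - 1 + 1 = h by ring, move_apply_self]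
  omega

theorem S_move_succ : (a.move h).S (h + 1) = a.S (h + 1) + 1 := by
  unfold S
  rw [move_apply_of_ne (h + 1 + 1) (by omega) (by omega), move_apply_succ]
  omega

theorem L_move_self (ha : 0 < a h) : (a.move h).L h = a.L h := by
  have h1 := S_move_pred ha
  have h2 := S_move_succ (a := a) (h := h)
  rw [L_eq_S, L_eq_S, S_move_of_ne h ha (by omega) (by omega)]
  omega

theorem L_move_pred (ha : 0 < a h) : (a.move h).L (h - 1) + 1 = a.L (h - 1) := by
  have h1 := S_move_pred ha
  rw [L_eq_S, L_eq_S, show h - 1 + 1 = h by ring, S_move_of_ne h ha (by omega) (by omega),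
    S_move_of_ne (h - 1 - 1) ha (by omega) (by omega)]
  omega

theorem L_move_pred_pred (ha : 0 < a h) : (a.move h).L (h - 2) + 1 = a.L (h - 2) := by
  have h1 := S_move_pred ha
  rw [L_eq_S, L_eq_S, show h - 2 + 1 = h - 1 by ring, S_move_of_ne (h - 2) ha (by omega) (by omega),
    S_move_of_ne (h - 2 - 1) ha (by omega) (by omega)]
  omega

theorem L_move_succ (ha : 0 < a h) : (a.move h).L (h + 1) = a.L (h + 1) + 1 := by
  have h1 := S_move_succ (a := a) (h := h)
  rw [L_eq_S, L_eq_S, show h + 1 - 1 = h by ring, S_move_of_ne h ha (by omega) (by omega),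
    S_move_of_ne (h + 1 + 1) ha (by omega) (by omega)]
  omega

theorem L_move_succ_succ (ha : 0 < a h) : (a.move h).L (h + 2) = a.L (h + 2) + 1 := by
  have h1 := S_move_succ (a := a) (h := h)
  rw [L_eq_S, L_eq_S, show h + 2 - 1 = h + 1 by ring, S_move_of_ne (h + 2) ha (by omega) (by omega),
    S_move_of_ne (h + 2 + 1) ha (by omega) (by omega)]
  omega

theorem L_move_of_gt (i : ℤ) (ha : 0 < a h) (hi : h + 2 < i) : (a.move h).L i = a.L i := by
  rw [L_eq_S, L_eq_S, S_move_of_ne (i - 1) ha (by omega) (by omega),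
    S_move_of_ne i ha (by omega) (by omega), S_move_of_ne (i + 1) ha (by omega) (by omega)]

theorem L_move_of_lt (i : ℤ) (ha : 0 < a h) (hi : i < h - 2) : (a.move h).L i = a.L i := by
  rw [L_eq_S, L_eq_S, S_move_of_ne (i - 1) ha (by omega) (by omega),
    S_move_of_ne i ha (by omega) (by omega), S_move_of_ne (i + 1) ha (by omega) (by omega)]

theorem isPos_move_self {k m : ℕ} (ha : 0 < a h) :
    IsPos k m (a.move h) h ↔ IsPos k m a h := by
  rw [IsPos, IsPos, L_move_self ha, S_move_of_ne h ha (by omega) (by omega)]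

end move

/-! ### Highest positions and right moves -/

section highest
variable {k m : ℕ} {a : Config} {h : ℤ}

theorem S_le (ha : a ∈ admissible k m) (i : ℤ) : a.S i ≤ m := ha.2.1 i
theorem L_le (ha : a ∈ admissible k m) (i : ℤ) : a.L i ≤ k + m := ha.2.2 i

theorem L_eq_triples (a : Config) (i : ℤ) : a.L i =
    (a (i - 1) + a i + a (i + 1)) + (a i + a (i + 1) + a (i + 2)) := by
  rw [L]; ring

theorem triple_le (ha : a ∈ admissible k m) (i : ℤ) : a i + a (i + 1) + a (i + 2) ≤ k := ha.1 i

theorem triple_le' (ha : a ∈ admissible k m) (i : ℤ) : a (i - 1) + a i + a (i + 1) ≤ k := by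
  have := ha.1 (i - 1)
  rwa [show i - 1 + 1 = i by ring, show i - 1 + 2 = i + 1 by ring] at this

/-- L is a sum of two consecutive triples, each at most k, so L = k + m forces both to be at least
m. -/
theorem IsPos.le_triple (hp : IsPos k m a h) (ha : a ∈ admissible k m) :
    m ≤ a h + a (h + 1) + a (h + 2) := by
  have := triple_le' ha h
  rcases hp with hp | hp
  · rw [S] at hp; omega
  · rw [L_eq_triples] at hp; omega

theorem IsPos.le_triple' (hp : IsPos k m a h) (ha : a ∈ admissible k m) :
    m ≤ a (h - 1) + a h + a (h + 1) := by
  have := triple_le ha h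
  rcases hp with hp | hp
  · rw [S] at hp; omega
  · rw [L_eq_triples] at hp; omega

theorem not_isPos_iff (ha : a ∈ admissible k m) (i : ℤ) :
    ¬ IsPos k m a i ↔ a.S i < m ∧ a.L i < k + m := by
  have h1 := S_le ha i
  have h2 := L_le ha i
  rw [IsPos]
  omega

theorem IsHighest.S_lt (hh : IsHighest k m a h) (ha : a ∈ admissible k m) {i : ℤ} (hi : h < i) :
    a.S i < m := ((not_isPos_iff ha i).1 (hh.2 i hi)).1

theorem IsHighest.L_lt (hh : IsHighest k m a h) (ha : a ∈ admissible k m) {i : ℤ} (hi : h < i) :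
    a.L i < k + m := ((not_isPos_iff ha i).1 (hh.2 i hi)).2

theorem IsHighest.apply_pos (hh : IsHighest k m a h) (ha : a ∈ admissible k m) : 0 < a h := by
  have h1 := hh.S_lt ha (i := h + 1) (by omega)
  have h3 := triple_le' ha h
  rw [S, show h + 1 + 1 = h + 2 by ring] at h1
  rcases hh.1 with hp | hp
  · rw [S] at hp
    omega
  · rw [L_eq_triples] at hp
    omega

theorem IsHighest.unique {h' : ℤ} (hh : IsHighest k m a h) (hh' : IsHighest k m a h') :
    h = h' := by
  rcases lt_trichotomy h h' with hl | hl | hl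
  · exact absurd hh'.1 (hh.2 _ hl)
  · exact hl
  · exact absurd hh.1 (hh'.2 _ hl)

theorem bddAbove_isPos (a : Config) (hm : 0 < m) : BddAbove {i | IsPos k m a i} := by
  obtain ⟨z, hz⟩ := a.exists_forall_gt_eq_zero
  refine ⟨z + 1, fun i hi => ?_⟩
  by_contra hlt
  have h1 := hz i (by omega)
  have h2 := hz (i + 1) (by omega)
  have h3 := hz (i - 1) (by omega)
  have h4 := hz (i + 2) (by omega)
  rcases hi with hi | hi
  · rw [S] at hi; omega
  · rw [L] at hi; omega

theorem HasWeight.isHighest (hw : HasWeight k m a) : IsHighest k m a (highestPos k m a) := by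
  have hb := bddAbove_isPos (k := k) a hw.2.2.1
  refine ⟨Int.csSup_mem hw.2.1 hb, fun i hi hp => ?_⟩
  exact absurd (le_csSup hb hp) (not_le.2 hi)

theorem IsHighest.highestPos_eq (hh : IsHighest k m a h) (hm : 0 < m) :
    highestPos k m a = h := by
  have hb := bddAbove_isPos (k := k) a hm
  refine IsHighest.unique (k := k) (m := m) (a := a) ⟨Int.csSup_mem ⟨h, hh.1⟩ hb, fun i hi hp => ?_⟩ hh
  exact absurd (le_csSup hb hp) (not_le.2 hi)

/-- The sums that can grow are S at h + 1, L at h + 1 and h + 2, and the triple starting at h + 1.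
The first three are strict because h is highest; the triple is strict because L at h + 1 is less
than k + m while the triple starting at h is at least m. -/
theorem IsHighest.move_mem (hh : IsHighest k m a h) (ha : a ∈ admissible k m) :
    a.move h ∈ admissible k m := by
  have h0 := hh.apply_pos ha
  refine ⟨fun i => ?_, fun i => ?_, fun i => ?_⟩
  · have hi := ha.1 i
    have e1 : h + 1 + 1 = h + 2 := by ring
    by_cases hi1 : i = h + 1
    · subst hi1
      have h1 := hh.L_lt ha (i := h + 1) (by omega)
      have h2 := hh.1.le_triple ha
      rw [L_eq_triples, show h + 1 - 1 = h by ring, e1] at h1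
      rw [move_apply_succ, move_apply_of_ne (h + 1 + 1) (by omega) (by omega),
        move_apply_of_ne (h + 1 + 2) (by omega) (by omega), e1]
      omega
    · by_cases hi2 : i = h
      · subst hi2
        rw [move_apply_succ, move_apply_self, move_apply_of_ne (i + 2) (by omega) (by omega)]
        omega
      · rw [move_apply_of_ne i hi2 hi1]
        by_cases hi3 : i = h - 1
        · subst hi3
          rw [show h - 1 + 1 = h by ring, show h - 1 + 2 = h + 1 by ring] at *
          rw [move_apply_succ, move_apply_self]
          omega
        · rw [move_apply_of_ne (i + 1) (by omega) (by omega)]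
          by_cases hi4 : i = h - 2
          · subst hi4
            rw [show h - 2 + 2 = h by ring] at *
            rw [move_apply_self]
            omega
          · rw [move_apply_of_ne (i + 2) (by omega) (by omega)]
            omega
  · have hi := S_le ha i
    by_cases h1 : i = h - 1
    · subst h1
      have := S_move_pred h0
      omega
    by_cases h2 : i = h + 1
    · subst h2
      have := hh.S_lt ha (i := h + 1) (by omega)
      rw [S_move_succ]
      omega
    · rw [S_move_of_ne i h0 h1 h2]
      exact hi
  · have hi := L_le ha i
    rcases lt_or_ge i (h - 2) with h1 | h1
    · rwa [L_move_of_lt i h0 h1]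
    rcases lt_or_ge (h + 2) i with h2 | h2
    · rwa [L_move_of_gt i h0 h2]
    have : i = h - 2 ∨ i = h - 1 ∨ i = h ∨ i = h + 1 ∨ i = h + 2 := by omega
    rcases this with rfl | rfl | rfl | rfl | rfl
    · have := L_move_pred_pred h0; omega
    · have := L_move_pred h0; omega
    · rwa [L_move_self h0]
    · have := hh.L_lt ha (i := h + 1) (by omega)
      rw [L_move_succ h0]; omega
    · have := hh.L_lt ha (i := h + 2) (by omega)
      rw [L_move_succ_succ h0]; omega

theorem HasWeight.move (hw : HasWeight k m a) (hh : IsHighest k m a h) :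
    HasWeight k m (a.move h) :=
  ⟨hh.move_mem hw.1, ⟨h, (isPos_move_self (hh.apply_pos hw.1)).2 hh.1⟩, hw.2.2⟩

/-- The highest position moves to the right by at most two, and by two only if
`S[h, a] < m`. -/
theorem IsHighest.move_cases {h' : ℤ} (hh : IsHighest k m a h) (ha : a ∈ admissible k m)
    (hh' : IsHighest k m (a.move h) h') :
    h' = h ∨ h' = h + 1 ∨ (h' = h + 2 ∧ a.S h < m ∧ a.L h = k + m) := by
  have h0 := hh.apply_pos ha
  have hge : h ≤ h' := by
    by_contra hlt
    exact hh'.2 h (by omega) ((isPos_move_self h0).2 hh.1)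
  rcases lt_or_ge (h + 2) h' with h2 | h2
  · have := hh'.1
    rw [IsPos, S_move_of_ne h' h0 (by omega) (by omega), L_move_of_gt h' h0 h2] at this
    exact absurd this (hh.2 h' (by omega))
  · have : h' = h ∨ h' = h + 1 ∨ h' = h + 2 := by omega
    rcases this with e | e | e
    · exact Or.inl e
    · exact Or.inr (Or.inl e)
    · refine Or.inr (Or.inr ⟨e, ?_⟩)
      subst e
      rcases Nat.lt_or_ge (a.S h) m with hS | hS
      · refine ⟨hS, ?_⟩
        rcases hh.1 with hp | hp
        · omega
        · exact hp
      -- With S_h = m, strictness of L at h + 1 gives S_{h+1} + S_{h+2} < k, and S_{h+3} < m then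
      -- keeps the raised L at h + 2 below k + m.
      · exfalso
        have hm := hh.S_lt ha (i := h + 1) (by omega)
        have hm2 := hh.S_lt ha (i := h + 2) (by omega)
        have hm3 := hh.S_lt ha (i := h + 3) (by omega)
        have hL := hh.L_lt ha (i := h + 1) (by omega)
        rcases hh'.1 with hp | hp
        · rw [S_move_of_ne (h + 2) h0 (by omega) (by omega)] at hp
          omega
        · rw [L_move_succ_succ h0, L_eq_S, show h + 2 - 1 = h + 1 by ring,
            show h + 2 + 1 = h + 3 by ring] at hp
          rw [L_eq_S, show h + 1 - 1 = h by ring, show h + 1 + 1 = h + 2 by ring] at hL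
          omega

end highest

end Config

/-! ### Energy profiles -/

/-- `Q` is the energy profile of the configuration `a` with respect to a test particle of
weight `m`. -/
structure IsProfile (k m : ℕ) (a : Config) (Q : ℤ → ℤ) : Prop where
  base : ∃ z, ∀ j ≤ z, Q j = m * (j + 1)
  step : ∀ j, Q (j + 2) = min (Q (j + 1) + (m - a.S (j + 1)))
    (min (Q j) (Q (j + 1)) + (k + m - a.L j))

theorem level_step_raise {q2 q3 q4 r4 u3 v2 : ℤ} (h3 : 0 ≤ u3) (h2 : 0 ≤ v2)
    (e4 : q4 = min (q3 + u3) (min q2 q3 + v2))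
    (f4 : r4 = min (q3 + 1 + u3) (min q2 (q3+1) + (v2+1))) :
    min (q3+1) r4 = min q3 q4 + 1 ∧ q4 ≤ min q3 q4 + u3 ∧ q4 + 1 ≤ r4 ∧ 
     (q4 + 1 < r4 → q3 + v2 ≤ q4) := by
  omega

/-- The local min-plus computation behind `IsProfile.move_eq_of_gt`. Here q and r are the profiles
before and after a move at h, with q3 at site h; u and v are the slacks of S and L, and d = m − n.
The hypothesis `hp` says that h is a position of weight n, the strict inequalities that nothing of
weight n lies further right, and `h34`, `h45` express that L is a sum of three consecutive S. -/
theorem profile_stabilizes (d q2 q3 q4 q5 q6 q7 r4 r5 r6 r7 u2 u3 u4 u5 u6 v2 v3 v4 v5: ℤ)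
 (h0 : 0 ≤ d)  (hu2 : d ≤ u2) (hu3 : d ≤ u3) (hu4 : d < u4) (hu5 : d < u5)
 (hv2 : d ≤ v2) (hv3 : d ≤ v3) (hv4 : d < v4)
 (hp : u3 = d ∨ v3 = d) (h34 : v4 + u2 = v3 + u5) (h45 : v5 + u3 = v4 + u6)
 (e4 : q4 = min (q3 + u3) (min q2 q3 + v2))
 (e5 : q5 = min (q4 + u4) (min q3 q4 + v3))
 (e6 : q6 = min (q5 + u5) (min q4 q5 + v4))
 (e7 : q7 = min (q6 + u6) (min q5 q6 + v5))
 (f4 : r4 = min (q3 + 1 + u3) (min q2 (q3+1) + (v2+1)))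
 (f5 : r5 = min (r4 + (u4-1)) (min (q3+1) r4 + v3))
 (f6 : r6 = min (r5 + u5) (min r4 r5 + (v4 - 1)))
 (f7 : r7 = min (r6 + u6) (min r5 r6 + (v5 - 1))) : r6 = q6 ∧ r7 = q7 := by
  obtain ⟨hR, hq, h4, h4'⟩ := level_step_raise (h0.trans hu3) (h0.trans hv2) e4 f4
  rw [hR] at f5
  rcases hp with hp | hp
  · have h4 : r4 = q4 + 1 := by clear e5 e6 e7 f5 f6 f7; omega
    clear e4 f4 hR h4'
    subst h4
    rcases le_or_gt (q4 + u4) (min q3 q4 + v3) with h | h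
    · have h5 : r5 = q5 := by rw [e5, f5]; clear e5 e6 e7 f5 f6 f7; omega
      have hq5 : q4 + d + 1 ≤ q5 := by clear e6 e7 f5 f6 f7; omega
      clear e5 f5
      subst h5
      have h6 : r6 = q6 := by clear e7 f7; omega
      refine ⟨h6, ?_⟩
      subst h6
      clear f6
      omega
    · have h5 : r5 = q5 + 1 := by rw [e5, f5]; clear e5 e6 e7 f5 f6 f7; omega
      have h5' : q5 = min q3 q4 + v3 := by clear e6 e7 f5 f6 f7; omega
      clear e5 f5
      subst h5
      have hR' : min (q4+1) (q5+1) = min q4 q5 + 1 := by clear e6 e7 f6 f7; omega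
      rw [hR'] at f6
      have h6' : q6 = min q4 q5 + v4 := by clear e7 f7 f6; omega
      have h6 : r6 = q6 := by clear e7 f7 e6; omega
      clear f6 e6
      refine ⟨h6, ?_⟩
      subst h6
      omega
  · have h5 : q5 = min q3 q4 + d := by clear e6 e7 f5 f6 f7 e4 f4; omega
    have h5' : r5 = q5 + 1 := by clear e6 e7 f6 f7 e4 f4; omega
    clear e5 f5
    subst h5'
    have hm : min q3 q4 ≤ min q4 q5 := by clear e6 e7 f6 f7 e4 f4; omega
    have hR' : min r4 (q5+1) = min q4 q5 + 1 := by clear e6 e7 f6 f7 f4; omega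
    clear e4 f4
    rw [hR'] at f6
    have h6 : r6 = q6 := by clear e7 f7; omega
    refine ⟨h6, ?_⟩
    have h7 : q5 + 1 ≤ q6 := by clear e7 f7 f6; omega
    subst h6
    clear f6 e6
    omega

namespace IsProfile

variable {k m : ℕ} {a b : Config} {Q Q' : ℤ → ℤ}

/-- To the left of the support the linear function solves the recurrence: m ≤ k makes the first
alternative of the minimum the smaller one. From there on the recurrence is run on pairs of
consecutive values. -/
theorem exists_profile (hm : m ≤ k) (a : Config) : ∃ Q, IsProfile k m a Q := by
  obtain ⟨z, hz⟩ := a.exists_forall_lt_eq_zero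
  let step : ℕ → ℤ × ℤ → ℤ × ℤ := fun n p => (p.2, min (p.2 + (m - a.S (z - 2 + n + 1)))
    (min p.1 p.2 + (k + m - a.L (z - 2 + n))))
  let f : ℕ → ℤ × ℤ := fun n => Nat.rec ((m : ℤ) * (z - 1), (m : ℤ) * z) step n
  let Q : ℤ → ℤ := fun j => if j ≤ z - 1 then m * (j + 1) else (f (j - (z - 1)).toNat).2
  have hf : ∀ n, f (n + 1) = step n (f n) := fun n => rfl
  have hQ : ∀ n : ℕ, Q (z - 1 + n) = (f n).2 := by
    intro n
    rcases Nat.eq_zero_or_pos n with rfl | hn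
    · simp only [Q]
      rw [if_pos (by omega)]
      simp [f]
    · simp only [Q]
      rw [if_neg (by omega)]
      congr 2
      omega
  have hQ' : ∀ n : ℕ, Q (z - 2 + n) = (f n).1 := by
    intro n
    rcases n with _ | n
    · simp only [Q]
      rw [if_pos (by push_cast; omega)]
      show (m : ℤ) * (z - 2 + ((0 : ℕ) : ℤ) + 1) = m * (z - 1)
      push_cast
      ring
    · rw [show z - 2 + ((n + 1 : ℕ) : ℤ) = z - 1 + n by push_cast; ring, hQ, hf]
  refine ⟨Q, ⟨z - 1, fun j hj => if_pos hj⟩, fun j => ?_⟩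
  rcases lt_or_ge j (z - 2) with hj | hj
  · have e0 : Q j = m * (j + 1) := if_pos (by omega)
    have e1 : Q (j + 1) = m * (j + 1 + 1) := if_pos (by omega)
    have e2 : Q (j + 2) = m * (j + 2 + 1) := if_pos (by omega)
    have hS : a.S (j + 1) = 0 := by
      rw [Config.S, hz (j + 1) (by omega), hz (j + 1 + 1) (by omega)]
    have hL : a.L j = a (j + 2) := by
      rw [Config.L, hz (j - 1) (by omega), hz j (by omega), hz (j + 1) (by omega)]
      omega
    rw [hL, hz (j + 2) (by omega), hS, e0, e1, e2]
    have : (m : ℤ) * (j + 1 + 1) = m * (j + 1) + m := by ring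
    have : (m : ℤ) * (j + 2 + 1) = m * (j + 1) + m + m := by ring
    omega
  · obtain ⟨n, rfl⟩ : ∃ n : ℕ, j = z - 2 + n := ⟨(j - (z - 2)).toNat, by omega⟩
    have e2 := hQ (n + 1)
    have e1 := hQ n
    have e0 := hQ' n
    rw [show z - 1 + ((n + 1 : ℕ) : ℤ) = z - 2 + n + 2 by push_cast; ring, hf] at e2
    rw [show z - 1 + (n : ℤ) = z - 2 + n + 1 by ring] at e1
    rw [e2, e1, e0]

/-- The value at j depends on S_i only for i < j, as L_{j−2} = S_{j−3} + S_{j−2} + S_{j−1}. -/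
theorem congr (hQ : IsProfile k m a Q) (hQ' : IsProfile k m b Q') {j₀ : ℤ}
    (hab : ∀ i < j₀, a.S i = b.S i) : ∀ j ≤ j₀, Q j = Q' j := by
  obtain ⟨z, hz⟩ := hQ.base
  obtain ⟨z', hz'⟩ := hQ'.base
  have key : ∀ n : ℕ, ∀ j ≤ min z z' + n, j ≤ j₀ → Q j = Q' j := by
    intro n
    induction n with
    | zero =>
      intro j hj _
      rw [hz j (by omega), hz' j (by omega)]
    | succ n ih =>
      intro j hj hj0
      obtain ⟨i, rfl⟩ : ∃ i, j = i + 2 := ⟨j - 2, by ring⟩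
      rw [hQ.step, hQ'.step, ih i (by omega) (by omega), ih (i + 1) (by omega) (by omega),
        Config.L_eq_S, Config.L_eq_S, hab _ (by omega), hab _ (by omega), hab _ (by omega)]
  intro j hj
  exact key (j - min z z').toNat j (by omega) hj

theorem unique (hQ : IsProfile k m a Q) (hQ' : IsProfile k m a Q') : Q = Q' :=
  funext fun j => hQ.congr hQ' (fun _ _ => rfl) j le_rfl

theorem succ_le (hQ : IsProfile k m a Q) (j : ℤ) : Q (j + 1) ≤ Q j + (m - a.S j) := by
  have := hQ.step (j - 1)
  rw [show j - 1 + 2 = j + 1 by ring, show j - 1 + 1 = j by ring] at this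
  omega

theorem level_le_succ (hQ : IsProfile k m a Q) (ha : a ∈ Config.admissible k m) (j : ℤ) :
    min (Q j) (Q (j + 1)) ≤ min (Q (j + 1)) (Q (j + 2)) := by
  have h1 := hQ.step j
  have h2 := Config.S_le ha (j + 1)
  have h3 := Config.L_le ha j
  omega

theorem level_mono (hQ : IsProfile k m a Q) (ha : a ∈ Config.admissible k m) {i j : ℤ}
    (hij : i ≤ j) : min (Q i) (Q (i + 1)) ≤ min (Q j) (Q (j + 1)) := by
  have key : ∀ n : ℕ, min (Q i) (Q (i + 1)) ≤ min (Q (i + n)) (Q (i + n + 1)) := by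
    intro n
    induction n with
    | zero => simp
    | succ n ih =>
      have := hQ.level_le_succ ha (i + n)
      push_cast
      rw [show i + (n + 1 : ℤ) = i + n + 1 by ring, show i + n + 1 + 1 = i + n + 2 by ring]
      exact ih.trans this
  have := key (j - i).toNat
  rwa [show i + ((j - i).toNat : ℤ) = j by omega] at this

/-- A vanishing slack of S gives Q_{h+1} ≤ Q_h, and a vanishing slack of L bounds Q_{h+2} by the
level at h; either way the level cannot rise. -/
theorem level_succ_eq (hQ : IsProfile k m a Q) (ha : a ∈ Config.admissible k m) {h : ℤ}
    (hp : Config.IsPos k m a h) :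
    min (Q (h + 1)) (Q (h + 2)) = min (Q h) (Q (h + 1)) := by
  have h1 := hQ.step h
  have h2 := hQ.level_le_succ ha h
  have h3 := hQ.succ_le h
  rcases hp with hp | hp <;> omega

theorem level_add_two_eq (hQ : IsProfile k m a Q) (ha : a ∈ Config.admissible k m) {h : ℤ}
    (hp : a.L h = k + m) :
    min (Q (h + 2)) (Q (h + 3)) = min (Q h) (Q (h + 1)) := by
  have h1 := hQ.step h
  have h2 := hQ.level_le_succ ha h
  have h3 := hQ.level_le_succ ha (h + 1)
  rw [show h + 1 + 1 = h + 2 by ring, show h + 1 + 2 = h + 3 by ring] at h3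
  omega

theorem le_mul (hQ : IsProfile k m a Q) (j : ℤ) : Q j ≤ m * (j + 1) := by
  obtain ⟨z, hz⟩ := hQ.base
  have key : ∀ n : ℕ, Q (z + n) ≤ m * (z + n + 1) := by
    intro n
    induction n with
    | zero => simp [hz z le_rfl]
    | succ n ih =>
      have := hQ.succ_le (z + n)
      push_cast
      rw [show z + (n + 1 : ℤ) = z + n + 1 by ring]
      have : (m : ℤ) * (z + n + 1 + 1) = m * (z + n + 1) + m := by ring
      omega
  rcases le_or_gt j z with h | h
  · exact (hz j h).le
  · have := key (j - z).toNat
    rwa [show z + ((j - z).toNat : ℤ) = j by omega] at this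

/-! ### Profiles under a right move -/

section move
variable {n : ℕ} {h : ℤ}

theorem move_eq_of_lt (hQ : IsProfile k m a Q) (hQ' : IsProfile k m (a.move h) Q') (h0 : 0 < a h)
    {j : ℤ} (hj : j < h) : Q' j = Q j :=
  hQ'.congr hQ (j₀ := h - 1) (fun i hi => Config.S_move_of_ne i h0 (by omega) (by omega)) j
    (by omega)

theorem move_self (hQ : IsProfile k m a Q) (hQ' : IsProfile k m (a.move h) Q') (h0 : 0 < a h) :
    Q' h = Q h + 1 := by
  have e := hQ.step (h - 2)
  have e' := hQ'.step (h - 2)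
  have h1 := Config.S_move_pred h0
  have h2 := Config.L_move_pred_pred h0
  rw [show h - 2 + 2 = h by ring, show h - 2 + 1 = h - 1 by ring] at e e'
  rw [hQ.move_eq_of_lt hQ' h0 (j := h - 1) (by omega),
    hQ.move_eq_of_lt hQ' h0 (j := h - 2) (by omega)] at e'
  omega

theorem step' (hQ : IsProfile k m a Q) (j : ℤ) : Q (j + 1) = min (Q j + (m - a.S j))
    (min (Q (j - 1)) (Q j) + (k + m - a.L (j - 1))) := by
  have := hQ.step (j - 1)
  rwa [show j - 1 + 2 = j + 1 by ring, show j - 1 + 1 = j by ring] at this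

theorem move_succ (hQ : IsProfile k m a Q) (hQ' : IsProfile k m (a.move h) Q') (h0 : 0 < a h) :
    Q' (h + 1) = min (Q h + 1 + (m - a.S h))
      (min (Q (h - 1)) (Q h + 1) + ((k + m - a.L (h - 1)) + 1)) := by
  have h2 := Config.L_move_pred h0
  rw [hQ'.step', hQ.move_self hQ' h0, hQ.move_eq_of_lt hQ' h0 (j := h - 1) (by omega),
    Config.S_move_of_ne h h0 (by omega) (by omega)]
  omega

theorem level_move (hQ : IsProfile k m a Q) (hQ' : IsProfile k m (a.move h) Q') (h0 : 0 < a h)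
    (ha : a ∈ Config.admissible k m) :
    min (Q' h) (Q' (h + 1)) = min (Q h) (Q (h + 1)) + 1 := by
  have hS := Config.S_le ha h
  have hL := Config.L_le ha (h - 1)
  rw [hQ.move_self hQ' h0]
  exact (level_step_raise (by omega) (by omega) (hQ.step' h) (hQ.move_succ hQ' h0)).1

/-- The level of the highest particle increases by one in each right move. -/
theorem level_highest_move {h' : ℤ} (hQ : IsProfile k m a Q)
    (hQ' : IsProfile k m (a.move h) Q') (hh : Config.IsHighest k m a h)
    (ha : a ∈ Config.admissible k m) (hh' : Config.IsHighest k m (a.move h) h') :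
    min (Q' h') (Q' (h' + 1)) = min (Q h) (Q (h + 1)) + 1 := by
  have h0 := hh.apply_pos ha
  have ha' := hh.move_mem ha
  rw [← hQ.level_move hQ' h0 ha]
  rcases hh.move_cases ha hh' with rfl | rfl | ⟨rfl, -, hL⟩
  · rfl
  · rw [show h + 1 + 1 = h + 2 by ring]
    exact hQ'.level_succ_eq ha' ((Config.isPos_move_self h0).2 hh.1)
  · rw [show h + 2 + 1 = h + 3 by ring]
    exact hQ'.level_add_two_eq ha' ((Config.L_move_self h0).trans hL)

/-- A right move of weight `n ≤ m` does not change the profile far to the right. -/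
theorem move_eq_of_gt (hQ : IsProfile k m a Q) (hQ' : IsProfile k m (a.move h) Q')
    (hnm : n ≤ m) (hh : Config.IsHighest k n a h) (ha : a ∈ Config.admissible k n) :
    ∀ j ≥ h + 3, Q' j = Q j := by
  have h0 := hh.apply_pos ha
  have e4 := hQ.step' h
  have f4 := hQ.move_succ hQ' h0
  have e5 := hQ.step h
  have f5 := hQ'.step h
  have e6 := hQ.step (h + 1)
  have f6 := hQ'.step (h + 1)
  have e7 := hQ.step (h + 2)
  have f7 := hQ'.step (h + 2)
  have s1 := Config.S_move_succ (a := a) (h := h)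
  have s2 := Config.S_move_of_ne (h + 2) h0 (by omega) (by omega)
  have s3 := Config.S_move_of_ne (h + 3) h0 (by omega) (by omega)
  have l1 := Config.L_move_self h0
  have l2 := Config.L_move_succ h0
  have l3 := Config.L_move_succ_succ h0
  rw [show h + 1 + 2 = h + 3 by ring, show h + 1 + 1 = h + 2 by ring] at e6 f6
  rw [show h + 2 + 2 = h + 4 by ring, show h + 2 + 1 = h + 3 by ring] at e7 f7
  have g1 := Config.L_eq_S a h
  have g2 := Config.L_eq_S a (h + 1)
  have g3 := Config.L_eq_S a (h + 2)
  rw [show h + 1 - 1 = h by ring, show h + 1 + 1 = h + 2 by ring] at g2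
  rw [show h + 2 - 1 = h + 1 by ring, show h + 2 + 1 = h + 3 by ring] at g3
  have b1 := Config.S_le ha (h - 1)
  have b2 := Config.S_le ha h
  have b3 := hh.S_lt ha (i := h + 1) (by omega)
  have b4 := hh.S_lt ha (i := h + 2) (by omega)
  have b5 := hh.S_lt ha (i := h + 3) (by omega)
  have c1 := Config.L_le ha (h - 1)
  have c2 := Config.L_le ha h
  have c3 := hh.L_lt ha (i := h + 1) (by omega)
  have c4 := hh.L_lt ha (i := h + 2) (by omega)
  rw [hQ.move_self hQ' h0] at f5
  have hp := hh.1
  obtain ⟨q6, q7⟩ := profile_stabilizes (d := m - n) (q2 := Q (h - 1)) (q3 := Q h)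
    (q4 := Q (h + 1)) (q5 := Q (h + 2)) (q6 := Q (h + 3)) (q7 := Q (h + 4))
    (r4 := Q' (h + 1)) (r5 := Q' (h + 2)) (r6 := Q' (h + 3)) (r7 := Q' (h + 4))
    (u2 := m - a.S (h - 1)) (u3 := m - a.S h) (u4 := m - a.S (h + 1)) (u5 := m - a.S (h + 2))
    (u6 := m - a.S (h + 3)) (v2 := k + m - a.L (h - 1)) (v3 := k + m - a.L h)
    (v4 := k + m - a.L (h + 1)) (v5 := k + m - a.L (h + 2))
    (by omega) (by omega) (by omega) (by omega) (by omega) (by omega) (by omega) (by omega)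
    (by rcases hp with hp | hp <;> [left; right] <;> omega) (by omega) (by omega)
    e4 e5 e6 e7 f4
    (by rw [f5, s1, l1]; push_cast; congr 2; ring)
    (by rw [f6, s2, l2]; push_cast; congr 2; ring)
    (by rw [f7, s3, l3]; push_cast; congr 2; ring)
  -- Two consecutive agreeing values suffice, since the recurrence beyond them only reads sums that
  -- the move leaves alone.
  have key : ∀ i : ℕ, Q' (h + 3 + i) = Q (h + 3 + i) ∧ Q' (h + 4 + i) = Q (h + 4 + i) := by
    intro i
    induction i with
    | zero => simpa using ⟨q6, q7⟩
    | succ i ih =>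
      have e1 : h + 3 + ((i + 1 : ℕ) : ℤ) = h + 4 + i := by push_cast; ring
      have e2 : h + 4 + ((i + 1 : ℕ) : ℤ) = h + 3 + i + 2 := by push_cast; ring
      refine ⟨by rw [e1]; exact ih.2, ?_⟩
      rw [e2, hQ.step, hQ'.step, ih.1, show h + 3 + (i : ℤ) + 1 = h + 4 + i by ring, ih.2,
        Config.S_move_of_ne _ h0 (by omega) (by omega), Config.L_move_of_gt _ h0 (by omega)]
  intro j hj
  have := (key (j - (h + 3)).toNat).1
  rwa [show h + 3 + ((j - (h + 3)).toNat : ℤ) = j by omega] at this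

end move

end IsProfile

/-! ### Profiles at the two ends of the support -/

namespace IsProfile

variable {k m n : ℕ} {a b c : Config} {Q Q' : ℤ → ℤ}

theorem zero (hm : m ≤ k) : IsProfile k m 0 fun j => m * (j + 1) := by
  refine ⟨⟨0, fun _ _ => rfl⟩, fun j => ?_⟩
  have e1 : (m : ℤ) * (j + 1 + 1) = m * (j + 1) + m := by ring
  have e2 : (m : ℤ) * (j + 2 + 1) = m * (j + 1) + m + m := by ring
  simp only [Config.S, Config.L, Finsupp.coe_zero, Pi.zero_apply, e1, e2]
  omega

/-- The profile at the left end of a configuration. -/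
theorem eq_left_end (hm : m ≤ k) (hQ : IsProfile k m a Q) (ha : a ∈ Config.admissible k m) {z : ℤ}
    (hz : ∀ i < z, a i = 0) :
    Q z = m * (z + 1) - a z ∧ Q (z + 1) = m * (z + 2) - 2 * a z - a (z + 1) := by
  have hc : ∀ j ≤ z - 1, Q j = m * (j + 1) := fun j hj =>
    hQ.congr (zero hm) (j₀ := z - 1) (fun i hi => Config.S_congr (by simp [hz i (by omega)])
      (by simp [hz (i + 1) (by omega)])) j hj
  have h1 : Q (z - 1) = m * z := by rw [hc _ le_rfl]; ring
  have h2 : Q (z - 2) = m * z - m := by rw [hc _ (by omega)]; ring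
  have e0 := hQ.step (z - 2)
  have e1 := hQ.step' z
  have hS := Config.S_le ha z
  rw [show z - 2 + 2 = z by ring, show z - 2 + 1 = z - 1 by ring, h1, h2] at e0
  rw [h1] at e1
  simp only [Config.S, Config.L, show z - 2 + 2 = z by ring, show z - 2 + 1 = z - 1 by ring,
    show z - 1 + 1 = z by ring, show z - 1 + 2 = z + 1 by ring, hz (z - 1) (by omega),
    hz (z - 2) (by omega), hz (z - 2 - 1) (by omega), hz (z - 1 - 1) (by omega)] at e0 e1 hS
  have r1 : (m : ℤ) * (z + 1) = m * z + m := by ring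
  have r2 : (m : ℤ) * (z + 2) = m * z + m + m := by ring
  rw [r1, r2]
  have h0 : Q z = m * z + m - a z := by rw [e0]; omega
  refine ⟨h0, ?_⟩
  rw [e1, h0]
  omega

/-- By monotonicity of levels it is enough that Q_{z+1} ≤ Q_{z+2}. In the recurrence the second
alternative exceeds Q_{z+1} by k − (a_z + a_{z+1} + a_{z+2}) ≥ 0. -/
theorem left_end_le (hm : m ≤ k) (hQ : IsProfile k m a Q) (ha : a ∈ Config.admissible k m) {z : ℤ}
    (hz : ∀ i < z, a i = 0) {j : ℤ} (hj : z < j) : Q (z + 1) ≤ min (Q j) (Q (j + 1)) := by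
  obtain ⟨h0, h1⟩ := hQ.eq_left_end hm ha hz
  refine le_trans ?_ (hQ.level_mono ha (i := z + 1) (j := j) (by omega))
  have h2 := hQ.step z
  have hS := Config.S_le ha (z + 1)
  have hS0 := Config.S_le ha z
  have hT := Config.triple_le ha z
  rw [show z + 1 + 1 = z + 2 by ring]
  have hL : a.L z = 2 * a z + 2 * a (z + 1) + a (z + 2) := by
    rw [Config.L, hz (z - 1) (by omega)]; ring
  have r : (m : ℤ) * (z + 2) = m * (z + 1) + m := by ring
  rw [Config.S] at hS0
  rw [r] at h1
  omega

theorem succ_eq_right_end (hm : m ≤ k) (hQ : IsProfile k m a Q) {M : ℤ} (hM : ∀ i ≥ M, a i = 0)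
    {j : ℤ} (hj : M + 2 ≤ j) : Q (j + 1) = Q j + m := by
  have h1 := hQ.step' j
  have h2 := hQ.succ_le (j - 1)
  rw [show j - 1 + 1 = j by ring] at h2
  have hS : a.S j = 0 := by rw [Config.S, hM _ (by omega), hM _ (by omega)]
  have hL : a.L (j - 1) = 0 := by
    rw [Config.L, hM _ (by omega), hM _ (by omega), hM _ (by omega), hM _ (by omega)]
  rw [hS, hL] at h1
  omega

theorem eq_right_end (hm : m ≤ k) (hQ : IsProfile k m a Q) {M : ℤ} (hM : ∀ i ≥ M, a i = 0)
    {i j : ℤ} (hi : M + 2 ≤ i) (hij : i ≤ j) : Q j = Q i + m * (j - i) := by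
  have key : ∀ t : ℕ, Q (i + t) = Q i + m * t := by
    intro t
    induction t with
    | zero => simp
    | succ t ih =>
      push_cast
      rw [← add_assoc, hQ.succ_eq_right_end hm hM (by omega), ih]
      ring
  have := key (j - i).toNat
  rwa [show i + ((j - i).toNat : ℤ) = j by omega, show ((j - i).toNat : ℤ) = j - i by omega] at this

end IsProfile

/-! ### Free particles and the phase shift -/

/-- The recurrence near a free particle of weight n at N, run with it (b) and without it (c); w and
y are S_{N−3} and S_{N−2} of the remainder. The profile c has slope m from N + 1 on, so c5 + 2m is
its value at N + 3, where b7 is taken. -/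
theorem single_particle_shift {k m n w y q2 q3 c4 c5 b4 b5 b6 b7 : ℤ} (hnm : n ≤ m) (hmk : m ≤ k)
    (hn : 0 ≤ n) (hy : 0 ≤ y) (hyn : y + n ≤ k) (hw0 : 0 ≤ w) (hwy : w + y ≤ k)
    (ec4 : c4 = min (q3 + m) (min q2 q3 + (k + m - w - y)))
    (ec5 : c5 = min (c4 + m) (min q3 c4 + (k + m - y)))
    (eb4 : b4 = c4 - n)
    (eb5 : b5 = min (b4 + (m - n)) (min q3 b4 + (k + m - y - 2 * n)))
    (eb6 : b6 = min (b5 + m) (min b4 b5 + (k + m - 2 * n)))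
    (eb7 : b7 = min (b6 + m) (min b5 b6 + (k + m - n))) :
    b7 = c5 + 2 * m - (2 * n + max (n + m - k) 0) := by
  subst eb4
  omega

namespace Config

variable {k m n : ℕ} {a b c : Config} {N : ℤ}

/-- `b` consists of the configuration `c` and of a free particle of weight `m` at `N`. -/
def IsFree (m : ℕ) (b c : Config) (N : ℤ) : Prop :=
  b = c + Finsupp.single N m ∧ ∀ i ≥ N - 1, c i = 0

namespace IsFree

theorem apply_of_ne (hf : IsFree m b c N) {i : ℤ} (hi : i ≠ N) : b i = c i := by
  rw [hf.1]
  simp [hi.symm]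

theorem apply_self (hf : IsFree m b c N) : b N = m := by
  rw [hf.1]
  simp [hf.2 N (by omega)]

theorem apply_of_gt (hf : IsFree m b c N) {i : ℤ} (hi : N < i) : b i = 0 := by
  rw [hf.apply_of_ne hi.ne', hf.2 i (by omega)]

theorem apply_pred (hf : IsFree m b c N) : b (N - 1) = 0 := by
  rw [hf.apply_of_ne (by omega), hf.2 _ (by omega)]

theorem apply_le (hf : IsFree m b c N) (i : ℤ) : c i ≤ b i := by
  rw [hf.1]; simp

theorem S_of_lt (hf : IsFree m b c N) {i : ℤ} (hi : i < N - 1) : b.S i = c.S i :=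
  S_congr (hf.apply_of_ne (by omega)) (hf.apply_of_ne (by omega))

theorem S_pred (hf : IsFree m b c N) : b.S (N - 1) = m := by
  rw [S, hf.apply_pred, show N - 1 + 1 = N by ring, hf.apply_self, zero_add]

theorem S_self (hf : IsFree m b c N) : b.S N = m := by
  rw [S, hf.apply_of_gt (i := N + 1) (by omega), hf.apply_self, add_zero]

theorem S_of_gt (hf : IsFree m b c N) {i : ℤ} (hi : N < i) : b.S i = 0 := by
  rw [S, hf.apply_of_gt hi, hf.apply_of_gt (by omega)]

theorem S_tail_eq_zero (hf : IsFree m b c N) {i : ℤ} (hi : N - 1 ≤ i) : c.S i = 0 := by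
  rw [S, hf.2 _ hi, hf.2 _ (by omega)]

theorem isHighest (hf : IsFree m b c N) (hm : 0 < m) (hmk : m ≤ k) : IsHighest k m b N := by
  refine ⟨Or.inl hf.S_self, fun i hi hp => ?_⟩
  rcases hp with hp | hp
  · rw [hf.S_of_gt hi] at hp; omega
  · rw [L, hf.apply_of_gt hi, hf.apply_of_gt (i := i + 1) (by omega),
      hf.apply_of_gt (i := i + 2) (by omega)] at hp
    rcases eq_or_lt_of_le (show N ≤ i - 1 by omega) with e | e
    · rw [← e, hf.apply_self] at hp; omega
    · rw [hf.apply_of_gt e] at hp; omega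

theorem tail_mem (hf : IsFree m b c N) (hb : b ∈ admissible k n) : c ∈ admissible k n := by
  have h := hf.apply_le
  refine ⟨fun i => le_trans ?_ (hb.1 i), fun i => le_trans ?_ (hb.2.1 i),
    fun i => le_trans ?_ (hb.2.2 i)⟩
  · have := h i; have := h (i + 1); have := h (i + 2); omega
  · have := h i; have := h (i + 1); rw [S, S]; omega
  · have := h i; have := h (i + 1); have := h (i + 2); have := h (i - 1); rw [L, L]; omega

end IsFree

end Config

namespace IsProfile

variable {k m n : ℕ} {b c : Config} {N : ℤ} {Q Q' : ℤ → ℤ}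

theorem free_eq_of_lt (hf : Config.IsFree n b c N) (hQ : IsProfile k m b Q)
    (hQ' : IsProfile k m c Q') {j : ℤ} (hj : j < N) : Q j = Q' j :=
  hQ.congr hQ' (j₀ := N - 1) (fun _ hi => hf.S_of_lt hi) j (by omega)

theorem free_apply_self (hf : Config.IsFree n b c N) (hQ : IsProfile k m b Q)
    (hQ' : IsProfile k m c Q') : Q N = Q' N - n := by
  have e := hQ.step (N - 2)
  have e' := hQ'.step (N - 2)
  have s1 := hf.S_of_lt (i := N - 2) (by omega)
  have s2 := hf.S_of_lt (i := N - 3) (by omega)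
  have s3 := hf.S_pred
  have s4 := hf.S_tail_eq_zero (i := N - 1) le_rfl
  rw [show N - 2 + 2 = N by ring, show N - 2 + 1 = N - 1 by ring, Config.L_eq_S,
    show N - 2 - 1 = N - 3 by ring, show N - 2 + 1 = N - 1 by ring] at e e'
  rw [free_eq_of_lt hf hQ hQ' (j := N - 2) (by omega),
    free_eq_of_lt hf hQ hQ' (j := N - 1) (by omega), s1, s2, s3] at e
  rw [s4] at e'
  omega

/-- A free particle of weight `n` shifts the profile by the phase shift `A_{m,n}`. -/
theorem free_eq_of_gt (hmk : m ≤ k) (hnm : n ≤ m) (hf : Config.IsFree n b c N)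
    (hb : b ∈ Config.admissible k n) (hQ : IsProfile k m b Q) (hQ' : IsProfile k m c Q') {j : ℤ}
    (hj : N + 3 ≤ j) : Q j = Q' j - phaseShift k m n := by
  have e4 := free_apply_self hf hQ hQ'
  have q2 := free_eq_of_lt hf hQ hQ' (j := N - 2) (by omega)
  have q3 := free_eq_of_lt hf hQ hQ' (j := N - 1) (by omega)
  have c4 := hQ'.step (N - 2)
  have c5 := hQ'.step (N - 1)
  have b5 := hQ.step (N - 1)
  have b6 := hQ.step N
  have b7 := hQ.step (N + 1)
  have hM : ∀ i ≥ N - 1, c i = 0 := hf.2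
  have hM' : ∀ i ≥ N + 1, b i = 0 := fun i hi => hf.apply_of_gt (by omega)
  have hT := Config.triple_le' hb (N - 1)
  have hL := Config.L_le hb (N - 2)
  have hS := Config.S_le hb (N - 3)
  have r1 := hQ'.eq_right_end hmk hM (i := N + 1) (j := j) (by omega) (by omega)
  have r2 := hQ.eq_right_end hmk hM' (i := N + 3) (j := j) (by omega) (by omega)
  have w := hf.S_of_lt (i := N - 3) (by omega)
  have y : c.S (N - 2) = c (N - 2) := by
    rw [Config.S, hM (N - 2 + 1) (by omega), add_zero]
  have y' := hf.S_of_lt (i := N - 2) (by omega)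
  rw [show N - 1 - 1 = N - 2 by ring, show N - 1 + 1 = N by ring, hf.apply_pred, hf.apply_self,
    hf.apply_of_ne (by omega)] at hT
  rw [Config.L_eq_S] at hL c4 c5 b5 b6 b7
  rw [show N - 2 - 1 = N - 3 by ring, show N - 2 + 1 = N - 1 by ring] at hL c4
  rw [show N - 2 + 2 = N by ring] at c4
  rw [show N - 1 + 2 = N + 1 by ring, show N - 1 + 1 = N by ring,
    show N - 1 - 1 = N - 2 by ring] at b5 c5
  rw [show N + 1 + 2 = N + 3 by ring, show N + 1 + 1 = N + 2 by ring,
    show N + 1 - 1 = N by ring] at b7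
  rw [hf.S_of_gt (i := N + 2) (by omega), hf.S_of_gt (i := N + 1) (by omega), hf.S_self] at b7
  rw [hf.S_of_gt (i := N + 1) (by omega), hf.S_self, hf.S_pred] at b6
  rw [hf.S_self, hf.S_pred, y'] at b5
  rw [hf.S_tail_eq_zero (i := N - 1) le_rfl] at c4 c5
  rw [hf.S_tail_eq_zero (i := N) (by omega)] at c5
  rw [hf.S_pred, w, y'] at hL
  rw [q3] at b5
  have key := single_particle_shift (k := k) (m := m) (n := n) (w := c.S (N - 3))
    (y := c.S (N - 2)) (q2 := Q' (N - 2)) (q3 := Q' (N - 1)) (c4 := Q' N) (c5 := Q' (N + 1))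
    (b4 := Q N) (b5 := Q (N + 1)) (b6 := Q (N + 2)) (b7 := Q (N + 3)) (by omega) (by omega)
    (by omega) (by omega) (by omega) (by omega) (by omega)
    (by rw [c4]; congr 2; push_cast; ring)
    (by rw [c5]; congr 2)
    e4
    (by rw [b5]; congr 2; push_cast; ring)
    (by rw [b6]; congr 2; push_cast; ring)
    (by rw [b7]; congr 2)
  have r3 : (m : ℤ) * (j - (N + 1)) = m * (j - (N + 3)) + 2 * m := by ring
  rw [r1, r2, key, phaseShift, r3]
  omega

/-- The level of a free particle in terms of the profile of the remaining configuration. -/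
theorem level_free (hmk : m ≤ k) (hf : Config.IsFree m b c N)
    (hb : b ∈ Config.admissible k m) (hQ : IsProfile k m b Q) (hQ' : IsProfile k m c Q') {j : ℤ}
    (hj : N + 1 ≤ j) : min (Q N) (Q (N + 1)) = Q' j - m * (j + 1 - N) := by
  have e4 := free_apply_self hf hQ hQ'
  have q3 := free_eq_of_lt hf hQ hQ' (j := N - 1) (by omega)
  have c5 := hQ'.step (N - 1)
  have b5 := hQ.step (N - 1)
  have hM : ∀ i ≥ N - 1, c i = 0 := hf.2
  have hT := Config.triple_le' hb (N - 1)
  have r1 := hQ'.eq_right_end hmk hM (i := N + 1) (j := j) (by omega) (by omega)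
  have y : c.S (N - 2) = c (N - 2) := by
    rw [Config.S, hM (N - 2 + 1) (by omega), add_zero]
  have y' := hf.S_of_lt (i := N - 2) (by omega)
  rw [show N - 1 - 1 = N - 2 by ring, show N - 1 + 1 = N by ring, hf.apply_pred, hf.apply_self,
    hf.apply_of_ne (by omega)] at hT
  rw [Config.L_eq_S] at c5 b5
  rw [show N - 1 + 2 = N + 1 by ring, show N - 1 + 1 = N by ring,
    show N - 1 - 1 = N - 2 by ring] at b5 c5
  rw [hf.S_self, hf.S_pred, y'] at b5
  rw [hf.S_tail_eq_zero (i := N - 1) le_rfl, hf.S_tail_eq_zero (i := N) (by omega)] at c5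
  rw [r1, show (m : ℤ) * (j + 1 - N) = m * (j - (N + 1)) + 2 * m by ring]
  omega

end IsProfile

/-! ### Trajectories and the removal of the free particle -/

namespace Config

variable {k m n : ℕ} {a b c : Config} {N h : ℤ} {t : ℕ}

theorem IsHighest.rightMove_eq (hh : IsHighest k m a h) (hm : 0 < m) :
    rightMove k m a = a.move h := by
  rw [Config.rightMove_eq, hh.highestPos_eq hm]

theorem HasWeight.rightMove (hw : HasWeight k m a) : HasWeight k m (rightMove k m a) :=
  hw.move hw.isHighest

theorem HasWeight.iterate (hw : HasWeight k m a) (t : ℕ) :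
    HasWeight k m ((Config.rightMove k m)^[t] a) := by
  induction t with
  | zero => exact hw
  | succ t ih => rw [Function.iterate_succ_apply']; exact ih.rightMove

theorem length_add (a b : Config) : (a + b).length = a.length + b.length :=
  Finsupp.sum_add_index' (fun _ => rfl) fun _ _ _ => rfl

theorem length_single (i : ℤ) (n : ℕ) : length (Finsupp.single i n) = n :=
  Finsupp.sum_single_index rfl

theorem length_move (h0 : 0 < a h) : (a.move h).length = a.length := by
  have e : a - Finsupp.single h 1 + Finsupp.single h 1 = a :=
    tsub_add_cancel_of_le (Finsupp.single_le_iff.2 h0)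
  rw [move, length_add, length_single]
  conv_rhs => rw [← e, length_add, length_single]

theorem HasWeight.length_rightMove (hw : HasWeight k m a) :
    (Config.rightMove k m a).length = a.length :=
  length_move (hw.isHighest.apply_pos hw.1)

theorem HasWeight.length_iterate (hw : HasWeight k m a) (t : ℕ) :
    ((Config.rightMove k m)^[t] a).length = a.length := by
  induction t with
  | zero => rfl
  | succ t ih => rw [Function.iterate_succ_apply', (hw.iterate t).length_rightMove, ih]

theorem HasWeight.ne_zero (hw : HasWeight k m a) : a ≠ 0 := by
  rintro rfl
  have := hw.2.2.1
  obtain ⟨i, hi | hi⟩ := hw.2.1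
  · simp [S] at hi; omega
  · simp [L] at hi; omega

theorem admissible_mono {l l' : ℕ} (hl : l ≤ l') : admissible k l ⊆ admissible k l' :=
  fun _ ha => ⟨ha.1, fun i => (ha.2.1 i).trans hl, fun i => (ha.2.2 i).trans (by omega)⟩

theorem HasWeight.weight_eq (hw : HasWeight k m a) : a.weight k = m := by
  refine le_antisymm (Nat.sInf_le hw.1) (le_csInf ⟨m, hw.1⟩ fun l hl => ?_)
  obtain ⟨i, hi | hi⟩ := hw.2.1
  · exact hi ▸ hl.2.1 i
  · have := hl.2.2 i; omega

theorem hasWeight_weight {l : ℕ} (hl : l ≤ k) (ha : a ∈ admissible k l) (h0 : a ≠ 0) :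
    HasWeight k (a.weight k) a ∧ a.weight k ≤ l := by
  have hmem : a ∈ admissible k (a.weight k) := Nat.sInf_mem (s := {l | a ∈ admissible k l}) ⟨l, ha⟩
  have hle : a.weight k ≤ l := Nat.sInf_le ha
  have hpos : 0 < a.weight k := by
    obtain ⟨i, hi⟩ := Finsupp.ne_iff.1 h0
    have := S_le hmem i
    rw [S] at this
    have : a i ≠ 0 := hi
    omega
  refine ⟨⟨hmem, ?_, hpos, hle.trans hl⟩, hle⟩
  by_contra hne
  push Not at hne
  have : a ∈ admissible k (a.weight k - 1) := by
    refine ⟨hmem.1, fun i => ?_, fun i => ?_⟩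
    · have := ((not_isPos_iff hmem i).1 (hne i)).1; omega
    · have := ((not_isPos_iff hmem i).1 (hne i)).2; omega
  have : a.weight k ≤ a.weight k - 1 := Nat.sInf_le this
  omega

theorem top_spec (h0 : a ≠ 0) : a (top a) ≠ 0 ∧ ∀ i > top a, a i = 0 := by
  obtain ⟨z, hz⟩ := a.exists_forall_gt_eq_zero
  have hb : BddAbove {i | a i ≠ 0} :=
    ⟨z, fun i hi => by_contra fun h => hi (hz i (by omega))⟩
  obtain ⟨i, hi⟩ := Finsupp.ne_iff.1 h0
  refine ⟨Int.csSup_mem (s := {i | a i ≠ 0}) ⟨i, hi⟩ hb, fun i hi => ?_⟩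
  by_contra h
  exact absurd (le_csSup hb h) (not_le.2 hi)

/-- Unless the first `t` moves fill the site `N + 1`, they take place at the sites up to `N`. -/
theorem HasWeight.iterate_apply_eq_zero (hw : HasWeight k m a) (hN : ∀ i > N, a i = 0)
    (ht : ∀ s < t, (Config.rightMove k m)^[s + 1] a (N + 1) = 0) :
    ∀ i > N, (Config.rightMove k m)^[t] a i = 0 := by
  induction t with
  | zero => exact hN
  | succ t ih =>
    have ih := ih fun s hs => ht s (by omega)
    have h1 := ht t (by omega)
    intro i hi
    rw [Function.iterate_succ_apply'] at h1 ⊢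
    have hh := (hw.iterate t).isHighest
    have h0 := hh.apply_pos (hw.iterate t).1
    rw [hh.rightMove_eq hw.2.2.1] at h1 ⊢
    set h := highestPos k m ((Config.rightMove k m)^[t] a)
    have hle : h ≤ N := by
      by_contra hlt
      rw [ih h (by omega)] at h0
      omega
    rcases eq_or_lt_of_le hle with e | e
    · rw [← e, move_apply_succ] at h1
      omega
    · rw [move_apply_of_ne i (by omega) (by omega)]
      exact ih i hi

theorem HasWeight.level_iterate (hw : HasWeight k m a) {h' : ℤ} {Q Q' : ℤ → ℤ}
    (hh : IsHighest k m a h) (hh' : IsHighest k m ((Config.rightMove k m)^[t] a) h')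
    (hQ : IsProfile k m a Q) (hQ' : IsProfile k m ((Config.rightMove k m)^[t] a) Q') :
    min (Q' h') (Q' (h' + 1)) = min (Q h) (Q (h + 1)) + t := by
  induction t generalizing h' Q' with
  | zero =>
    rw [IsHighest.unique hh' hh, hQ'.unique hQ]
    simp
  | succ t ih =>
    rw [Function.iterate_succ_apply'] at hh' hQ'
    have hw' := hw.iterate t
    have hh1 := hw'.isHighest
    obtain ⟨Q₁, hQ₁⟩ := IsProfile.exists_profile hw.2.2.2 ((Config.rightMove k m)^[t] a)
    have e := ih hh1 hQ₁
    rw [hh1.rightMove_eq hw.2.2.1] at hh' hQ'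
    rw [hQ₁.level_highest_move hQ' hh1 hw'.1 hh', e]
    push_cast
    ring

/-- If the site N + 1 were never filled, the highest position would stay at most N and its level at
most m(N + 1), although every move raises it by one. -/
theorem HasWeight.exists_freeTime (hw : HasWeight k m a) (hN : ∀ i > N, a i = 0) :
    ∃ t, (Config.rightMove k m)^[t + 1] a (N + 1) ≠ 0 := by
  by_contra! hne
  obtain ⟨Q, hQ⟩ := IsProfile.exists_profile hw.2.2.2 a
  have hh := hw.isHighest
  set q := min (Q (highestPos k m a)) (Q (highestPos k m a + 1)) with hq
  set t := (m * (N + 1) - q + 1).toNat with ht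
  have hw' := hw.iterate t
  have hh' := hw'.isHighest
  obtain ⟨Q', hQ'⟩ := IsProfile.exists_profile hw.2.2.2 ((Config.rightMove k m)^[t] a)
  have e := hw.level_iterate hh hh' hQ hQ'
  have h0 := hh'.apply_pos hw'.1
  have hle : highestPos k m ((Config.rightMove k m)^[t] a) ≤ N := by
    by_contra hlt
    rw [hw.iterate_apply_eq_zero hN (fun s _ => hne s) _ (not_le.1 hlt)] at h0
    omega
  have h1 := hQ'.le_mul (highestPos k m ((Config.rightMove k m)^[t] a))
  have h2 : (m : ℤ) * (highestPos k m ((Config.rightMove k m)^[t] a) + 1) ≤ m * (N + 1) := by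
    gcongr
  omega

theorem HasWeight.isFree_freed (hw : HasWeight k m a) :
    IsFree m (freed k m a) (removeFree k m a) (top a) := by
  obtain ⟨htop, hN⟩ := top_spec hw.ne_zero
  have hex := hw.exists_freeTime hN
  have hspec : (Config.rightMove k m)^[freeTime k m a + 1] a (top a + 1) ≠ 0 :=
    Nat.sInf_mem (s := {t | (Config.rightMove k m)^[t + 1] a (top a + 1) ≠ 0}) hex
  have hmin : ∀ s < freeTime k m a, (Config.rightMove k m)^[s + 1] a (top a + 1) = 0 :=
    fun s hs => by_contra fun h => Nat.notMem_of_lt_sInf hs h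
  have hsupp := hw.iterate_apply_eq_zero hN hmin
  have hw' := hw.iterate (freeTime k m a)
  change ∀ i > top a, freed k m a i = 0 at hsupp
  change HasWeight k m (freed k m a) at hw'
  have hh := hw'.isHighest
  rw [Function.iterate_succ_apply'] at hspec
  change Config.rightMove k m (freed k m a) _ ≠ 0 at hspec
  rw [hh.rightMove_eq hw.2.2.1] at hspec
  change (freed k m a).move (highestPos k m (freed k m a)) _ ≠ 0 at hspec
  have hpos : highestPos k m (freed k m a) = top a := by
    have h0 := hh.apply_pos hw'.1
    by_contra hne
    by_cases e : top a + 1 = highestPos k m (freed k m a)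
    · rw [← e, hsupp _ (by omega)] at h0
      omega
    · rw [move_apply_of_ne _ e (by omega)] at hspec
      exact hspec (hsupp _ (by omega))
  rw [hpos] at hh
  have z1 := hsupp (top a + 1) (by omega)
  have z2 := hsupp (top a + 2) (by omega)
  have hS := S_le hw'.1 (top a - 1)
  have hS' := S_le hw'.1 (top a)
  have hmk := hw.2.2.2
  rw [S, show top a - 1 + 1 = top a by ring] at hS
  -- If L = k + m, the sites beyond `top a` being empty, then a_{top−1} + 2a_top = k + m together
  -- with a_{top−1} + a_top ≤ m gives a_top ≥ k ≥ m.
  have hm : freed k m a (top a) = m := by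
    rcases hh.1 with hp | hp
    · rw [S] at hp; omega
    · rw [L] at hp
      omega
  constructor
  · ext i
    rw [removeFree, Finsupp.add_apply, Finsupp.filter_apply, Finsupp.single_apply]
    rcases lt_trichotomy i (top a) with hi | hi | hi
    · rw [if_pos hi, if_neg hi.ne', add_zero]
    · rw [if_neg hi.not_lt, if_pos hi.symm, hi, hm, zero_add]
    · rw [if_neg hi.not_gt, if_neg hi.ne, hsupp i hi, add_zero]
  · intro i hi
    rw [removeFree, Finsupp.filter_apply]
    split_ifs with hlt
    · rw [show i = top a - 1 by omega]
      omega
    · rfl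

theorem IsFree.length_eq (hf : IsFree m b c N) : b.length = c.length + m := by
  rw [hf.1, length_add, length_single]

theorem HasWeight.length_removeFree (hw : HasWeight k m a) :
    (removeFree k m a).length + m = a.length := by
  rw [← hw.isFree_freed.length_eq]
  exact hw.length_iterate _

/-- The states between two free states. -/
theorem IsFree.iterate (hf : IsFree m b c N) (hw : HasWeight k m b) {r : ℕ} (hr : r ≤ m) :
    (Config.rightMove k m)^[r] b
      = c + Finsupp.single N (m - r) + Finsupp.single (N + 1) r := by
  induction r with
  | zero => simp [hf.1]
  | succ r ih =>
    have ih := ih (by omega)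
    have hm := hw.2.2.1
    have hmk := hw.2.2.2
    rw [Function.iterate_succ_apply', ih]
    set d := c + Finsupp.single N (m - r) + Finsupp.single (N + 1) r with hd
    have d0 : d N = m - r := by simp [hd, hf.2 N (by omega)]
    have d1 : d (N + 1) = r := by simp [hd, hf.2 (N + 1) (by omega)]
    have d2 : ∀ i > N + 1, d i = 0 := fun i hi => by
      simp [hd, hf.2 i (by omega), show N ≠ i by omega, show N + 1 ≠ i by omega]
    have hh : IsHighest k m d N := by
      refine ⟨Or.inl (by rw [S, d0, d1]; omega), fun i hi hp => ?_⟩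
      have e1 := d2 (i + 1) (by omega)
      have e2 := d2 (i + 2) (by omega)
      rcases eq_or_lt_of_le (show N + 1 ≤ i by omega) with e | e
      · subst e
        rcases hp with hp | hp
        · rw [S] at hp; omega
        · rw [L, show N + 1 - 1 = N by ring] at hp; omega
      · have e0 := d2 i e
        have e3 : d (i - 1) ≤ r := by
          rcases eq_or_lt_of_le (show N + 1 ≤ i - 1 by omega) with e' | e'
          · rw [← e', d1]
          · rw [d2 _ e']; omega
        rcases hp with hp | hp
        · rw [S] at hp; omega
        · rw [L] at hp; omega
    rw [hh.rightMove_eq hm, hd, move]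
    ext i
    simp only [Finsupp.add_apply, Finsupp.tsub_apply, Finsupp.single_apply]
    by_cases h1 : N = i
    · subst h1
      simp
      have := hf.2 N (by omega)
      omega
    · by_cases h2 : N + 1 = i <;> simp [h1, h2]; omega

theorem IsFree.iterate_self (hf : IsFree m b c N) (hw : HasWeight k m b) :
    IsFree m ((Config.rightMove k m)^[m] b) c (N + 1) := by
  refine ⟨?_, fun i hi => hf.2 i (by omega)⟩
  rw [hf.iterate hw le_rfl]
  simp

/-- The remaining configuration of a free state does not depend on the free state. -/
theorem IsFree.tail_unique {c' : Config} {N' : ℤ} (hf : IsFree m b c N) (hw : HasWeight k m b)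
    (hf' : IsFree m ((Config.rightMove k m)^[t] b) c' N') : c = c' := by
  induction t using Nat.strong_induction_on generalizing b N with
  | _ t ih =>
    rcases lt_or_ge t m with ht | ht
    · have e := hf.iterate hw ht.le
      have hb := hf'.1
      rcases Nat.eq_zero_or_pos t with rfl | ht0
      · have hN : N = N' :=
          IsHighest.unique (hf.isHighest hw.2.2.1 hw.2.2.2) (hf'.isHighest hw.2.2.1 hw.2.2.2)
        have := hf'.1
        rw [Function.iterate_zero_apply, hf.1, hN] at this
        exact add_right_cancel this
      -- Strictly between two free states the last occupied site N + 1 carries t < m units, so the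
      -- state is not free.
      · exfalso
        set d := (Config.rightMove k m)^[t] b
        have d1 : d (N + 1) = t := by simp [e, hf.2 (N + 1) (by omega)]
        have d2 : ∀ i > N + 1, d i = 0 := fun i hi => by
          simp [e, hf.2 i (by omega), show N ≠ i by omega, show N + 1 ≠ i by omega]
        rcases lt_trichotomy N' (N + 1) with hN | hN | hN
        · rw [hf'.apply_of_gt hN] at d1; omega
        · rw [← hN, hf'.apply_self] at d1; omega
        · have := d2 _ hN
          rw [hf'.apply_self] at this
          have := hw.2.2.1
          omega
    · refine ih (t - m) (by have := hw.2.2.1; omega) (hf.iterate_self hw) (hw.iterate m) ?_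
      rwa [← Function.iterate_add_apply, Nat.sub_add_cancel ht]

theorem HasWeight.removeFree_eq (hw : HasWeight k m a)
    (hf : IsFree m ((Config.rightMove k m)^[t] a) c N) : removeFree k m a = c := by
  have hf₀ := hw.isFree_freed
  rw [freed] at hf₀
  rcases le_total t (freeTime k m a) with h | h
  · refine (hf.tail_unique (hw.iterate t) (t := freeTime k m a - t) (N' := top a) ?_).symm
    rwa [← Function.iterate_add_apply, Nat.sub_add_cancel h]
  · refine hf₀.tail_unique (hw.iterate _) (t := t - freeTime k m a) (N' := N) ?_
    rwa [← Function.iterate_add_apply, Nat.sub_add_cancel h]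

theorem HasWeight.removeFree_rightMove (hw : HasWeight k m a) :
    removeFree k m (Config.rightMove k m a) = removeFree k m a := by
  have hf := hw.rightMove.isFree_freed
  rw [freed, ← Function.iterate_succ_apply] at hf
  exact (hw.removeFree_eq hf).symm

/-- Induction along the trajectory of `a`, backwards from its free state. -/
theorem HasWeight.trajectory_induction {P : Config → Prop} {c : Config}
    (hfree : ∀ b N, HasWeight k m b → IsFree m b c N → P b)
    (hmove : ∀ a h, HasWeight k m a → IsHighest k m a h → P (a.move h) → P a)
    (hw : HasWeight k m a) (hc : removeFree k m a = c) : P a := by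
  subst hc
  have hf := hw.isFree_freed
  have key : ∀ t a', HasWeight k m a' →
      (Config.rightMove k m)^[t] a' = freed k m a → P a' := by
    intro t
    induction t with
    | zero =>
      intro a' hw' e
      rw [Function.iterate_zero_apply] at e
      exact hfree a' _ hw' (e ▸ hf)
    | succ t ih =>
      intro a' hw' e
      rw [Function.iterate_succ_apply] at e
      refine hmove a' _ hw' hw'.isHighest ?_
      exact ih _ hw'.rightMove e
  exact key _ a hw rfl

end Config

/-! ### The configuration without its highest particle -/

namespace Config

variable {k m n : ℕ} {a b c : Config} {N h : ℤ}

/-- Clear for a free state, and it pulls back along right moves because the highest position never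
goes left. Consequently the profiles of the configuration and of its remainder agree to the left of
h. -/
theorem HasWeight.removeFree_apply (hw : HasWeight k m a) (hh : IsHighest k m a h) :
    (∀ i < h, removeFree k m a i = a i) ∧ removeFree k m a h < a h := by
  refine hw.trajectory_induction (P := fun a => ∀ h, IsHighest k m a h →
    (∀ i < h, removeFree k m _ i = a i) ∧ removeFree k m _ h < a h) ?_ ?_ rfl h hh
  · intro b N hw hf h hh
    obtain rfl := IsHighest.unique hh (hf.isHighest hw.2.2.1 hw.2.2.2)
    refine ⟨fun i hi => (hf.apply_of_ne hi.ne).symm, ?_⟩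
    rw [hf.apply_self, hf.2 _ (by omega)]
    exact hw.2.2.1
  · intro b h hw hh ih h₂ hh₂
    obtain rfl := IsHighest.unique hh hh₂
    have hh' := (hw.move hh).isHighest
    have h0 := hh.apply_pos hw.1
    obtain ⟨ih1, ih2⟩ := ih _ hh'
    have hle : h ≤ highestPos k m (b.move h) := by
      rcases hh.move_cases hw.1 hh' with e | e | e <;> omega
    refine ⟨fun i hi => ?_, ?_⟩
    · rw [ih1 i (by omega), move_apply_of_ne i (by omega) (by omega)]
    · rcases eq_or_lt_of_le hle with e | e
      · rw [← e, move_apply_self] at ih2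
        omega
      · rw [ih1 h e, move_apply_self]
        omega

/-- A separation of particles of equal weight, pulled back from the free state. It could fail only
if the highest position advances. But a sum lowered by the move would have exceeded its bound
before, and an advance by two requires S_h < m. -/
theorem HasWeight.lt_of_isPos_removeFree (hw : HasWeight k m a) (hh : IsHighest k m a h) (i : ℤ) :
    ((removeFree k m a).S i = m → i + 2 ≤ h) ∧
      ((removeFree k m a).L i = k + m → i + 3 ≤ h) := by
  refine hw.trajectory_induction (P := fun b => ∀ h, IsHighest k m b h →
    removeFree k m b = removeFree k m a → ((removeFree k m a).S i = m → i + 2 ≤ h) ∧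
      ((removeFree k m a).L i = k + m → i + 3 ≤ h)) ?_ ?_ rfl h hh rfl
  · intro b N hw hf h hh _
    obtain rfl := IsHighest.unique hh (hf.isHighest hw.2.2.1 hw.2.2.2)
    have hm := hw.2.2.1
    refine ⟨fun hS => ?_, fun hL => ?_⟩
    · by_contra hlt
      rw [hf.S_tail_eq_zero (by omega)] at hS
      omega
    · by_contra hlt
      have hT := triple_le hw.1 (h - 2)
      have hS := S_le (hf.tail_mem hw.1) (h - 3)
      rw [S, show h - 3 + 1 = h - 2 by ring] at hS
      rw [show h - 2 + 1 = h - 1 by ring, show h - 2 + 2 = h by ring, hf.apply_self,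
        hf.apply_pred, hf.apply_of_ne (by omega)] at hT
      rw [L, hf.2 (i + 1) (by omega), hf.2 (i + 2) (by omega)] at hL
      rcases lt_trichotomy i (h - 1) with e | e | e
      · rw [show i = h - 2 by omega, show h - 2 - 1 = h - 3 by ring] at hL
        omega
      · rw [hf.2 i (by omega), show i - 1 = h - 2 by omega] at hL
        omega
      · rw [hf.2 i (by omega), hf.2 (i - 1) (by omega)] at hL
        omega
  · intro b h hw hh ih h₂ hh₂ e
    obtain rfl := IsHighest.unique hh hh₂
    have hw' := hw.move hh
    have hh' := hw'.isHighest
    have h0 := hh.apply_pos hw.1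
    have e' : removeFree k m (b.move h) = removeFree k m a := by
      rw [← hh.rightMove_eq hw.2.2.1, hw.removeFree_rightMove, e]
    obtain ⟨ih1, ih2⟩ := ih _ hh' e'
    obtain ⟨happ, -⟩ := hw'.removeFree_apply hh'
    rw [e'] at happ
    have hc := hh.move_cases hw.1 hh'
    refine ⟨fun hS => ?_, fun hL => ?_⟩
    · have h1 := ih1 hS
      by_contra hlt
      have hS' : (b.move h).S i = m := by
        rw [← hS]
        exact S_congr (happ _ (by omega)).symm (happ _ (by omega)).symm
      rcases eq_or_lt_of_le (show h ≤ i + 1 by omega) with e1 | e1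
      · have h2 := S_move_pred h0
        have h3 := S_le hw.1 i
        rw [show h - 1 = i by omega] at h2
        omega
      · rcases hc with e2 | e2 | ⟨e2, e3, -⟩
        · omega
        · omega
        · obtain rfl : i = h := by omega
          rw [S_move_of_ne i h0 (by omega) (by omega)] at hS'
          omega
    · have h1 := ih2 hL
      by_contra hlt
      have hL' : (b.move h).L i = k + m := by
        rw [← hL, L, L, happ _ (by omega), happ _ (by omega), happ _ (by omega), happ _ (by omega)]
      have h3 := L_le hw.1 i
      rcases eq_or_lt_of_le (show h ≤ i + 2 by omega) with e1 | e1
      · have h2 := L_move_pred_pred h0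
        rw [show h - 2 = i by omega] at h2
        omega
      rcases eq_or_lt_of_le (show h ≤ i + 1 by omega) with e2 | e2
      · have h2 := L_move_pred h0
        rw [show h - 1 = i by omega] at h2
        omega
      · omega

theorem HasWeight.removeFree_mem (hw : HasWeight k m a) : removeFree k m a ∈ admissible k m :=
  hw.isFree_freed.tail_mem (hw.iterate _).1

theorem HasWeight.profile_removeFree_eq (hw : HasWeight k m a) (hh : IsHighest k m a h)
    {Q Q' : ℤ → ℤ} (hQ : IsProfile k n a Q) (hQ' : IsProfile k n (removeFree k m a) Q') :
    ∀ j < h, Q' j = Q j := by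
  have happ := (hw.removeFree_apply hh).1
  intro j hj
  exact hQ'.congr hQ (j₀ := h - 1)
    (fun i hi => S_congr (happ _ (by omega)) (happ _ (by omega))) j (by omega)

/-- Particles of equal weight have ordered levels. -/
theorem HasWeight.level_removeFree_le (hw : HasWeight k m a) (hh : IsHighest k m a h)
    {h' : ℤ} (hh' : IsHighest k m (removeFree k m a) h') {Q Q' : ℤ → ℤ}
    (hQ : IsProfile k m a Q) (hQ' : IsProfile k m (removeFree k m a) Q') :
    min (Q' h') (Q' (h' + 1)) ≤ min (Q h) (Q (h + 1)) := by
  have hlt : h' + 2 ≤ h := by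
    obtain ⟨h1, h2⟩ := hw.lt_of_isPos_removeFree hh h'
    rcases hh'.1 with hp | hp
    · exact h1 hp
    · have := h2 hp; omega
  rw [hw.profile_removeFree_eq hh hQ hQ' h' (by omega),
    hw.profile_removeFree_eq hh hQ hQ' (h' + 1) (by omega)]
  exact hQ.level_mono hw.1 (by omega)

/-- The level of the highest particle in terms of the profile of the configuration without
this particle. -/
theorem HasWeight.level_eq (hw : HasWeight k m a) (hh : IsHighest k m a h) {Q Q' : ℤ → ℤ}
    (hQ : IsProfile k m a Q) (hQ' : IsProfile k m (removeFree k m a) Q') {j : ℤ}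
    (hj : top a + 1 ≤ j) :
    min (Q h) (Q (h + 1)) = Q' j - m * (j + 1) + shiftedEnergy k m a := by
  have hf := hw.isFree_freed
  have hw' : HasWeight k m (freed k m a) := hw.iterate _
  obtain ⟨Q₁, hQ₁⟩ := IsProfile.exists_profile hw.2.2.2 (freed k m a)
  have e1 := hw.level_iterate hh (t := freeTime k m a) (hf.isHighest hw.2.2.1 hw.2.2.2) hQ hQ₁
  have e2 := IsProfile.level_free hw.2.2.2 hf hw'.1 hQ₁ hQ' hj
  rw [shiftedEnergy, hf.apply_self, hf.apply_of_gt (i := top a + 1) (by omega)]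
  have e3 : (m : ℤ) * (j + 1 - top a) = m * (j + 1) - m * top a := by ring
  have e4 : (top a : ℤ) * m = m * top a := by ring
  rw [e4]
  push_cast
  omega

theorem HasWeight.profile_right_end (hw : HasWeight k n a) (hnm : n ≤ m) (hmk : m ≤ k)
    {Q Q' : ℤ → ℤ} (hQ : IsProfile k m a Q) (hQ' : IsProfile k m (removeFree k n a) Q') :
    ∃ J, ∀ j ≥ J, Q j = Q' j - phaseShift k m n := by
  refine hw.trajectory_induction (P := fun a => ∀ Q, IsProfile k m a Q →
    ∃ J, ∀ j ≥ J, Q j = Q' j - phaseShift k m n) ?_ ?_ rfl Q hQ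
  · intro b N hw hf Q hQ
    exact ⟨N + 3, fun j hj => IsProfile.free_eq_of_gt hmk hnm hf hw.1 hQ hQ' hj⟩
  · intro b h hw hh ih Q hQ
    obtain ⟨Q₁, hQ₁⟩ := IsProfile.exists_profile hmk (b.move h)
    obtain ⟨J, hJ⟩ := ih Q₁ hQ₁
    refine ⟨max J (h + 3), fun j hj => ?_⟩
    rw [← hJ j (by omega), hQ.move_eq_of_gt hQ₁ hnm hh hw.1 j (by omega)]

end Config

/-! ### Content and rigging in terms of the profile -/

open Config

theorem contentAux_zero (k n : ℕ) : contentAux k n 0 = [] := by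
  cases n <;> simp [contentAux]

theorem contentAux_succ {k m n : ℕ} {a : Config} (hw : HasWeight k m a) :
    contentAux k (n + 1) a = (m, a.shiftedEnergy k m -
      ((contentAux k n (removeFree k m a)).map fun y => (phaseShift k m y.1 : ℤ)).sum) ::
        contentAux k n (removeFree k m a) := by
  rw [contentAux, if_neg hw.ne_zero, hw.weight_eq]

/-- Each removal lowers the length by the positive weight of the particle, so any fuel of at least
the length yields the same list. -/
theorem contentAux_eq_content {k n : ℕ} {a : Config} (ha : a ∈ admissible k k)
    (hn : a.length ≤ n) : contentAux k n a = content k a := by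
  have key : ∀ n (a : Config), a ∈ admissible k k → ∀ n', a.length ≤ n → a.length ≤ n' →
      contentAux k n a = contentAux k n' a := by
    intro n
    induction n with
    | zero =>
      intro a ha n' h1 h2
      by_cases h0 : a = 0
      · rw [h0, contentAux_zero, contentAux_zero]
      · obtain ⟨hw, -⟩ := hasWeight_weight le_rfl ha h0
        have := hw.length_removeFree
        have := hw.2.2.1
        omega
    | succ n ih =>
      intro a ha n' h1 h2
      by_cases h0 : a = 0
      · rw [h0, contentAux_zero, contentAux_zero]
      · obtain ⟨hw, -⟩ := hasWeight_weight le_rfl ha h0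
        have h3 := hw.length_removeFree
        have h4 := hw.2.2.1
        obtain ⟨n', rfl⟩ : ∃ j, n' = j + 1 := ⟨n' - 1, by omega⟩
        rw [contentAux_succ hw, contentAux_succ hw,
          ih _ (admissible_mono hw.2.2.2 hw.removeFree_mem) n' (by omega) (by omega)]
  exact key n a ha _ hn le_rfl

theorem content_zero (k : ℕ) : content k 0 = [] := contentAux_zero _ _

theorem content_eq_cons_shiftedEnergy {k m : ℕ} {a : Config} (hw : HasWeight k m a) :
    content k a = (m, a.shiftedEnergy k m -
      ((content k (removeFree k m a)).map fun y => (phaseShift k m y.1 : ℤ)).sum) ::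
        content k (removeFree k m a) := by
  have h1 := hw.length_removeFree
  have h2 := hw.2.2.1
  have h3 : contentAux k (a.length - 1) (removeFree k m a) = content k (removeFree k m a) :=
    contentAux_eq_content (admissible_mono hw.2.2.2 hw.removeFree_mem) (by omega)
  rw [content, show a.length = a.length - 1 + 1 by omega, contentAux_succ hw, h3]

theorem admissible_induction {k : ℕ} {P : Config → Prop} (h0 : P 0)
    (hcons : ∀ m a, HasWeight k m a → P (removeFree k m a) → P a) {a : Config}
    (ha : a ∈ admissible k k) : P a := by
  induction hn : a.length using Nat.strong_induction_on generalizing a with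
  | _ n ih =>
    by_cases ha0 : a = 0
    · rw [ha0]; exact h0
    · obtain ⟨hw, -⟩ := hasWeight_weight le_rfl ha ha0
      have h1 := hw.length_removeFree
      have h2 := hw.2.2.1
      exact hcons _ a hw (ih _ (by omega) (admissible_mono hw.2.2.2 hw.removeFree_mem) rfl)

/-- This identifies the sum of the A_{λ_1,λ_j} in the definition of ρ_1 as the asymptotic defect of
the profile of the remainder, so that it cancels in `content_eq_cons`. -/
theorem profile_right_end_content {k m : ℕ} {a : Config} (hmk : m ≤ k) (ha : a ∈ admissible k m)
    {Q : ℤ → ℤ} (hQ : IsProfile k m a Q) : ∃ J, ∀ j ≥ J,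
      Q j = m * (j + 1) - ((content k a).map fun y => (phaseShift k m y.1 : ℤ)).sum := by
  refine admissible_induction (k := k) (P := fun a => a ∈ admissible k m → ∀ Q,
    IsProfile k m a Q → ∃ J, ∀ j ≥ J, Q j = m * (j + 1) -
      ((content k a).map fun y => (phaseShift k m y.1 : ℤ)).sum) ?_ ?_
    (admissible_mono hmk ha) ha Q hQ
  · intro _ Q hQ
    refine ⟨0, fun j _ => ?_⟩
    rw [hQ.unique (IsProfile.zero hmk), content_zero]
    simp
  · intro n a hw ih ha Q hQ
    have hnm : n ≤ m := by
      rw [← hw.weight_eq]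
      exact Nat.sInf_le ha
    obtain ⟨Q', hQ'⟩ := IsProfile.exists_profile hmk (removeFree k n a)
    obtain ⟨J, hJ⟩ := ih (admissible_mono hnm hw.removeFree_mem) Q' hQ'
    obtain ⟨J', hJ'⟩ := hw.profile_right_end hnm hmk hQ hQ'
    refine ⟨max J J', fun j hj => ?_⟩
    rw [hJ' j (by omega), hJ j (by omega), content_eq_cons_shiftedEnergy hw, List.map_cons,
      List.sum_cons]
    ring

/-- The rigging of the first particle is the level of the profile at the highest position. -/
theorem content_eq_cons {k m : ℕ} {a : Config} {h : ℤ} {Q : ℤ → ℤ} (hw : HasWeight k m a)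
    (hh : IsHighest k m a h) (hQ : IsProfile k m a Q) :
    content k a = (m, min (Q h) (Q (h + 1))) :: content k (removeFree k m a) := by
  obtain ⟨Q', hQ'⟩ := IsProfile.exists_profile hw.2.2.2 (removeFree k m a)
  obtain ⟨J, hJ⟩ := profile_right_end_content hw.2.2.2 hw.removeFree_mem hQ'
  rw [content_eq_cons_shiftedEnergy hw,
    hw.level_eq hh hQ hQ' (j := max J (top a + 1)) (by omega), hJ _ (by omega)]
  congr 2
  ring


/-- The remainder has no larger weight, and for equal weights its highest level is bounded by
`HasWeight.level_removeFree_le`; later entries follow by transitivity. -/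
theorem content_mem_riggedPartitions {k l : ℕ} {a : Config} (hl : l ≤ k)
    (ha : a ∈ admissible k l) : content k a ∈ riggedPartitions l := by
  refine admissible_induction (k := k) (P := fun a => ∀ l ≤ k, a ∈ admissible k l →
    content k a ∈ riggedPartitions l) ?_ ?_ (admissible_mono hl ha) l hl ha
  · intro l _ _
    rw [content_zero]
    exact ⟨by simp, List.Pairwise.nil⟩
  · intro m a hw ih l hl ha
    have hml : m ≤ l := by
      rw [← hw.weight_eq]
      exact Nat.sInf_le ha
    obtain ⟨Q, hQ⟩ := IsProfile.exists_profile hw.2.2.2 a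
    have hh := hw.isHighest
    have hc := ih m hw.2.2.2 hw.removeFree_mem
    rw [content_eq_cons hw hh hQ]
    constructor
    · intro x hx
      rcases List.mem_cons.1 hx with rfl | hx
      · exact ⟨hw.2.2.1, hml⟩
      · exact ⟨(hc.1 x hx).1, (hc.1 x hx).2.trans hml⟩
    · refine List.pairwise_cons.2 ⟨fun y hy => ⟨(hc.1 y hy).2, fun hmy => ?_⟩, hc.2⟩
      change m = y.1 at hmy
      by_cases h0 : removeFree k m a = 0
      · rw [h0, content_zero] at hy
        simp at hy
      · obtain ⟨hw', hle⟩ := hasWeight_weight hw.2.2.2 hw.removeFree_mem h0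
        obtain ⟨Q₁, hQ₁⟩ := IsProfile.exists_profile hw'.2.2.2 (removeFree k m a)
        rw [content_eq_cons hw' hw'.isHighest hQ₁] at hy hc
        have hm' : (removeFree k m a).weight k = m := by
          rcases List.mem_cons.1 hy with rfl | hy'
          · exact hmy.symm
          · have := (List.pairwise_cons.1 hc.2).1 y hy'
            exact le_antisymm hle (hmy ▸ this.1)
        rw [hm'] at hw' hQ₁ hy hc
        have hlev := hw.level_removeFree_le hh hw'.isHighest hQ hQ₁
        rcases List.mem_cons.1 hy with rfl | hy'
        · exact hlev
        · exact (((List.pairwise_cons.1 hc.2).1 y hy').2 hmy).trans hlev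

/-! ### Boundary values as inequalities on riggings -/

/-- The conditions on a rigged partition which characterize the configurations supported on
`{z, z + 1, …}` with the values `A`, `B` at `z`, `z + 1`. -/
def HasBoundary (z : ℤ) (A B : ℕ) (p : RiggedData) : Prop :=
  (∀ x ∈ p, z * x.1 ≤ x.2 ∧ z * x.1 + x.1 - A ≤ x.2 ∧ z * x.1 + 2 * x.1 - 2 * A - B ≤ x.2) ∧
    (0 < A → ∃ x ∈ p, x.2 = z * x.1 + x.1 - A) ∧
    (0 < B → ∃ x ∈ p, x.2 = z * x.1 + 2 * x.1 - 2 * A - B)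

/-- Induction on the removal of the highest particle, at h. For h = z it satisfies a_z + a_{z+1} = m
and attains both bounds; for h = z + 1 its level is Q_{z+1}, the second bound, and a_z is untouched;
for h > z + 1 the boundary values do not change and the level is at least Q_{z+1}. -/
theorem content_hasBoundary {k : ℕ} {a : Config} (ha : a ∈ admissible k k) {z : ℤ}
    (hz : ∀ i < z, a i = 0) : HasBoundary z (a z) (a (z + 1)) (content k a) := by
  refine admissible_induction (k := k) (P := fun a => (∀ i < z, a i = 0) →
    HasBoundary z (a z) (a (z + 1)) (content k a)) ?_ ?_ ha hz
  · intro _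
    rw [content_zero]
    exact ⟨by simp, by simp, by simp⟩
  · intro m a hw ih hz
    obtain ⟨Q, hQ⟩ := IsProfile.exists_profile hw.2.2.2 a
    have hh := hw.isHighest
    set h := highestPos k m a
    have h0 := hh.apply_pos hw.1
    have hzh : z ≤ h := by
      by_contra hlt
      rw [hz h (by omega)] at h0
      omega
    obtain ⟨hc, hch⟩ := hw.removeFree_apply hh
    obtain ⟨ih1, ih2, ih3⟩ := ih fun i hi => by rw [hc i (by omega), hz i hi]
    have hcm := (content_mem_riggedPartitions hw.2.2.2 hw.removeFree_mem).1
    obtain ⟨q0, q1⟩ := hQ.eq_left_end hw.2.2.2 hw.1 hz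
    have r1 : (m : ℤ) * (z + 1) = z * m + m := by ring
    have r2 : (m : ℤ) * (z + 2) = z * m + 2 * m := by ring
    rw [r1] at q0
    rw [r2] at q1
    have hS := S_le hw.1 z
    rw [S] at hS
    rw [content_eq_cons hw hh hQ]
    rcases eq_or_lt_of_le hzh with e | hlt
    · have hT := triple_le hw.1 z
      have hSm : a z + a (z + 1) = m := by
        have hp := hh.1
        rw [← e] at hp
        rcases hp with hp | hp
        · exact hp
        · rw [L, hz (z - 1) (by omega)] at hp
          omega
      rw [← e] at hch ⊢
      refine ⟨fun x hx => ?_, fun _ => ⟨_, List.mem_cons_self, ?_⟩,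
        fun _ => ⟨_, List.mem_cons_self, ?_⟩⟩
      · rcases List.mem_cons.1 hx with rfl | hx
        · dsimp only
          omega
        · obtain ⟨b1, b2, b3⟩ := ih1 x hx
          -- As λ ≤ m = a_z + a_{z+1}, the second lower bound for x is no larger than the first.
          have := (hcm x hx).2
          omega
      · dsimp only
        omega
      · dsimp only
        omega
    · have hle := hQ.left_end_le hw.2.2.2 hw.1 hz hlt
      rw [hc z hlt] at ih1 ih2 ih3
      rcases eq_or_lt_of_le (show z + 1 ≤ h by omega) with e | hlt'
      · rw [← e] at hch hle ⊢
        refine ⟨fun x hx => ?_, fun hA => ?_, fun _ => ⟨_, List.mem_cons_self, ?_⟩⟩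
        · rcases List.mem_cons.1 hx with rfl | hx
          · dsimp only
            omega
          · obtain ⟨b1, b2, b3⟩ := ih1 x hx
            omega
        · obtain ⟨x, hx, e⟩ := ih2 hA
          exact ⟨x, List.mem_cons_of_mem _ hx, e⟩
        · dsimp only
          omega
      · rw [hc (z + 1) hlt'] at ih1 ih3
        refine ⟨fun x hx => ?_, fun hA => ?_, fun hB => ?_⟩
        · rcases List.mem_cons.1 hx with rfl | hx
          · dsimp only
            omega
          · exact ih1 x hx
        · obtain ⟨x, hx, e⟩ := ih2 hA
          exact ⟨x, List.mem_cons_of_mem _ hx, e⟩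
        · obtain ⟨x, hx, e⟩ := ih3 hB
          exact ⟨x, List.mem_cons_of_mem _ hx, e⟩

/-- The value attained for the larger candidate violates the inequality for the smaller one. -/
theorem HasBoundary.unique {A B A' B' : ℕ} {p : RiggedData} (h : HasBoundary 0 A B p)
    (h' : HasBoundary 0 A' B' p) : A = A' ∧ B = B' := by
  obtain ⟨h1, h2, h3⟩ := h
  obtain ⟨h1', h2', h3'⟩ := h'
  have hA : A = A' := by
    rcases lt_trichotomy A A' with hl | hl | hl
    · obtain ⟨x, hx, e⟩ := h2' (by omega)
      have := h1 x hx
      omega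
    · exact hl
    · obtain ⟨x, hx, e⟩ := h2 (by omega)
      have := h1' x hx
      omega
  refine ⟨hA, ?_⟩
  rcases lt_trichotomy B B' with hl | hl | hl
  · obtain ⟨x, hx, e⟩ := h3' (by omega)
    have := h1 x hx
    omega
  · exact hl
  · obtain ⟨x, hx, e⟩ := h3 (by omega)
    have := h1' x hx
    omega

/-! ### Undoing right moves; surjectivity of ι -/

namespace Config

variable {k m : ℕ} {a c : Config}

theorem bddBelow_isPos (a : Config) (hm : 0 < m) : ∃ z, ∀ i, IsPos k m a i → z ≤ i := by
  obtain ⟨z, hz⟩ := a.exists_forall_lt_eq_zero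
  refine ⟨z - 2, fun i hi => ?_⟩
  by_contra hlt
  have h1 := hz i (by omega)
  have h2 := hz (i + 1) (by omega)
  have h3 := hz (i - 1) (by omega)
  have h4 := hz (i + 2) (by omega)
  rcases hi with hi | hi
  · rw [S] at hi; omega
  · rw [L] at hi; omega

/-- If the site `j` of a particle of weight `m` can be refilled from `j + 1`, then `a` is a
right move. -/
theorem exists_move_eq {h j : ℤ} (hw : HasWeight k m a) (hh : IsHighest k m a h)
    (hj : IsPos k m a j) (h1 : ¬ IsPos k m a (j - 1)) (h2 : a.L (j - 2) ≠ k + m)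
    (h3 : a.S j = m → h ≤ j + 1) (h4 : h ≤ j + 2) :
    ∃ a', HasWeight k m a' ∧ IsHighest k m a' j ∧ a'.move j = a := by
  have ha := hw.1
  obtain ⟨hS1, hL1⟩ := (not_isPos_iff ha _).1 h1
  have hT := triple_le ha j
  have hL2 : a.L (j - 2) < k + m := lt_of_le_of_ne (L_le ha _) h2
  have hj1 : 0 < a (j + 1) := by
    rw [S, show j - 1 + 1 = j by ring] at hS1
    rcases hj with hp | hp
    · rw [S] at hp; omega
    · rw [L_eq_triples] at hp; omega
  -- Makes room for one more unit at j: L at j − 1 is less than k + m, while its other triple is at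
  -- least m.
  have hT2 : a (j - 2) + a (j - 1) + a j < k := by
    have hT1 := hj.le_triple' ha
    rw [L_eq_triples, show j - 1 - 1 = j - 2 by ring, show j - 1 + 1 = j by ring,
      show j - 1 + 2 = j + 1 by ring] at hL1
    omega
  set a' : Config := a - Finsupp.single (j + 1) 1 + Finsupp.single j 1 with ha'
  have hmove : a'.move j = a := by
    rw [move, ha', add_tsub_cancel_right]
    exact tsub_add_cancel_of_le (Finsupp.single_le_iff.2 hj1)
  have h0 : 0 < a' j := by simp [ha']
  have v1 := move_apply_self (a := a') (h := j)
  have v2 := move_apply_succ (a := a') (h := j)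
  have v3 := fun i => move_apply_of_ne (a := a') (h := j) i
  have s1 := S_move_pred h0
  have s2 := S_move_succ (a := a') (h := j)
  have s3 := fun i => S_move_of_ne i h0
  have l0 := L_move_self h0
  have l1 := L_move_pred h0
  have l2 := L_move_pred_pred h0
  have l3 := L_move_succ h0
  have l4 := L_move_succ_succ h0
  have l5 := fun i => L_move_of_gt i h0
  have l6 := fun i => L_move_of_lt i h0
  have hpos := isPos_move_self (k := k) (m := m) h0
  rw [hmove] at v1 v2 v3 s1 s2 s3 l0 l1 l2 l3 l4 l5 l6 hpos
  have hmem : a' ∈ admissible k m := by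
    refine ⟨fun i => ?_, fun i => ?_, fun i => ?_⟩
    · have hi := triple_le ha i
      by_cases e1 : i = j + 1
      · subst e1
        rw [v3 (j + 1 + 1) (by omega) (by omega), v3 (j + 1 + 2) (by omega) (by omega)] at hi
        omega
      by_cases e2 : i = j
      · subst e2
        rw [v3 (i + 2) (by omega) (by omega)] at hi
        omega
      rw [v3 i e2 e1] at hi
      by_cases e3 : i = j - 1
      · subst e3
        rw [show j - 1 + 1 = j by ring, show j - 1 + 2 = j + 1 by ring] at *
        omega
      rw [v3 (i + 1) (by omega) (by omega)] at hi
      by_cases e4 : i = j - 2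
      · subst e4
        rw [v3 _ (by omega) (by omega), v3 _ (by omega) (by omega)] at hT2
        rw [show j - 2 + 1 = j - 1 by ring, show j - 2 + 2 = j by ring]
        omega
      rwa [v3 (i + 2) (by omega) (by omega)] at hi
    · have hi := S_le ha i
      by_cases e1 : i = j - 1
      · subst e1; omega
      by_cases e2 : i = j + 1
      · subst e2; omega
      rwa [s3 i e1 e2] at hi
    · have hi := L_le ha i
      rcases lt_or_ge i (j - 2) with e | e
      · rwa [l6 i e] at hi
      rcases lt_or_ge (j + 2) i with e' | e'
      · rwa [l5 i e'] at hi
      have : i = j - 2 ∨ i = j - 1 ∨ i = j ∨ i = j + 1 ∨ i = j + 2 := by omega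
      rcases this with rfl | rfl | rfl | rfl | rfl <;> omega
  refine ⟨a', ⟨hmem, ⟨j, hpos.1 hj⟩, hw.2.2⟩, ⟨hpos.1 hj, fun i hi => ?_⟩, hmove⟩
  refine (not_isPos_iff hmem i).2 ⟨?_, ?_⟩
  · by_cases e1 : i = j + 1
    · have := S_le ha i
      subst e1; omega
    · rw [← s3 i (by omega) e1]
      by_contra hlt
      have hi' : a.S i = m := le_antisymm (S_le ha i) (by omega)
      have hih : i ≤ h := by
        by_contra hlt'
        exact hh.2 i (by omega) (Or.inl hi')
      -- S at j + 2 is the one sum not lowered by the refilling that could still be critical. It is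
      -- not: S_j ≠ m gives L_j = k + m, and L_{j+1} − L_j = S_{j+2} − S_{j−1} would be positive.
      obtain rfl : i = j + 2 := by omega
      have hSj : a.S j ≠ m := fun e => by have := h3 e; omega
      have hLj : a.L j = k + m := by
        rcases hj with hp | hp
        · exact absurd hp hSj
        · exact hp
      have hL := L_le ha (j + 1)
      rw [L_eq_S] at hLj hL
      rw [show j + 1 - 1 = j by ring, show j + 1 + 1 = j + 2 by ring] at hL
      omega
  · rcases lt_or_ge (j + 2) i with e' | e'
    · rw [← l5 i e']
      exact hh.L_lt ha (by omega)
    · have hi' := L_le ha i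
      have : i = j + 1 ∨ i = j + 2 := by omega
      rcases this with rfl | rfl <;> omega

/-- The level of the highest particle can be lowered as long as it exceeds the level of the
next particle of the same weight. -/
theorem HasWeight.exists_rightMove_eq {h : ℤ} {Q : ℤ → ℤ} (hw : HasWeight k m a)
    (hh : IsHighest k m a h) (hQ : IsProfile k m a Q)
    (hlt : ∀ h' Q', IsHighest k m (removeFree k m a) h' →
      IsProfile k m (removeFree k m a) Q' →
        min (Q' h') (Q' (h' + 1)) < min (Q h) (Q (h + 1))) :
    ∃ a' h' Q', HasWeight k m a' ∧ removeFree k m a' = removeFree k m a ∧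
      IsHighest k m a' h' ∧ IsProfile k m a' Q' ∧
        min (Q h) (Q (h + 1)) = min (Q' h') (Q' (h' + 1)) + 1 := by
  have ha := hw.1
  obtain ⟨z, hz⟩ := bddBelow_isPos (k := k) a hw.2.2.1
  -- The lowest position sharing the level of the highest particle is the site to refill: levels are
  -- constant across positions, so minimality excludes positions just below j.
  obtain ⟨j, ⟨hj, hjR⟩, hmin⟩ := Int.exists_least_of_bdd
    (P := fun i => IsPos k m a i ∧ min (Q i) (Q (i + 1)) = min (Q h) (Q (h + 1)))
    ⟨z, fun i hi => hz i hi.1⟩ ⟨h, hh.1, rfl⟩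
  have hc := (hw.removeFree_apply hh).1
  obtain ⟨Q₁, hQ₁⟩ := IsProfile.exists_profile hw.2.2.2 (removeFree k m a)
  -- Such a j would belong to the remainder, whose highest level would then be at least that of h.
  have hnot : ¬ (IsPos k m (removeFree k m a) j ∧ j + 2 ≤ h) := by
    rintro ⟨hp, hle⟩
    have hw' : HasWeight k m (removeFree k m a) := ⟨hw.removeFree_mem, ⟨j, hp⟩, hw.2.2⟩
    have hh' := hw'.isHighest
    have h1 := hlt _ _ hh' hQ₁
    have h2 : j ≤ highestPos k m (removeFree k m a) := by
      by_contra hlt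
      exact hh'.2 j (by omega) hp
    have h3 := hQ₁.level_mono hw'.1 h2
    rw [hw.profile_removeFree_eq hh hQ hQ₁ j (by omega),
      hw.profile_removeFree_eq hh hQ hQ₁ (j + 1) (by omega), hjR] at h3
    omega
  obtain ⟨a', hw', hh', rfl⟩ := exists_move_eq hw hh hj
    (fun hp => by
      have e := hQ.level_succ_eq ha hp
      rw [show j - 1 + 1 = j by ring, show j - 1 + 2 = j + 1 by ring, hjR] at e
      have := hmin (j - 1) ⟨hp, by rw [show j - 1 + 1 = j by ring, ← e]⟩
      omega)
    (fun hp => by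
      have e := hQ.level_add_two_eq ha hp
      rw [show j - 2 + 2 = j by ring, show j - 2 + 3 = j + 1 by ring, hjR] at e
      have := hmin (j - 2) ⟨Or.inr hp, e.symm⟩
      omega)
    (fun hS => by
      by_contra hlt
      refine hnot ⟨Or.inl ?_, by omega⟩
      exact (S_congr (hc j (by omega)) (hc (j + 1) (by omega))).trans hS)
    (by
      by_contra hlt
      refine hnot ⟨?_, by omega⟩
      have e1 := S_congr (hc j (by omega)) (hc (j + 1) (by omega))
      have e2 : (removeFree k m a).L j = a.L j := by
        rw [L, L, hc _ (by omega), hc _ (by omega), hc _ (by omega), hc _ (by omega)]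
      rw [IsPos, e1, e2]
      exact hj)
  obtain ⟨Q', hQ'⟩ := IsProfile.exists_profile hw'.2.2.2 a'
  refine ⟨a', j, Q', hw', ?_, hh', hQ', hQ'.level_highest_move hQ hh' hw'.1 hh⟩
  rw [← hh'.rightMove_eq hw'.2.2.1, hw'.removeFree_rightMove]

/-- A free particle far to the right of a configuration. -/
theorem exists_isFree {M : ℤ} (hm : 0 < m) (hmk : m ≤ k) (hc : c ∈ admissible k m)
    (hM : ∀ i ≥ M, c i = 0) {N : ℤ} (hN : M + 3 ≤ N) :
    ∃ b, IsFree m b c N ∧ HasWeight k m b := by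
  have hf : IsFree m (c + Finsupp.single N m) c N := ⟨rfl, fun i hi => hM i (by omega)⟩
  set b := c + Finsupp.single N m
  have hb : ∀ i, M ≤ i → i ≠ N → b i = 0 := fun i h1 h2 => by
    rw [hf.apply_of_ne h2, hM i h1]
  have hN' := hf.apply_self
  refine ⟨b, hf, ⟨fun i => ?_, fun i => ?_, fun i => ?_⟩,
    ⟨N, (hf.isHighest hm hmk).1⟩, hm, hmk⟩
  · rcases lt_or_ge (i + 2) N with h | h
    · rw [hf.apply_of_ne (by omega), hf.apply_of_ne (by omega), hf.apply_of_ne (by omega)]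
      exact hc.1 i
    · by_cases e : N = i ∨ N = i + 1 ∨ N = i + 2
      · rcases e with rfl | rfl | rfl
        · rw [hb (N + 1) (by omega) (by omega), hb (N + 2) (by omega) (by omega)]; omega
        · rw [hb i (by omega) (by omega), hb (i + 2) (by omega) (by omega)]; omega
        · rw [hb i (by omega) (by omega), hb (i + 1) (by omega) (by omega)]; omega
      · rw [hb i (by omega) (by omega), hb (i + 1) (by omega) (by omega),
          hb (i + 2) (by omega) (by omega)]
        omega
  · rcases lt_or_ge i (N - 1) with h | h
    · rw [hf.S_of_lt h]
      exact hc.2.1 i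
    · by_cases e : N - 1 = i ∨ N = i
      · rcases e with rfl | rfl
        · exact hf.S_pred.le
        · exact hf.S_self.le
      · rw [hf.S_of_gt (by omega)]
        omega
  · rw [L_eq_S]
    rcases lt_or_ge (i + 1) (N - 1) with h | h
    · rw [hf.S_of_lt h, hf.S_of_lt (by omega), hf.S_of_lt (by omega), ← L_eq_S]
      exact hc.2.2 i
    · have e1 := hf.S_pred
      have e2 := hf.S_self
      have e3 := hf.S_of_gt (i := N + 1) (by omega)
      have e4 := hf.S_of_gt (i := N + 2) (by omega)
      have e5 : b.S (N - 2) = 0 := by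
        rw [S, hb _ (by omega) (by omega), hb _ (by omega) (by omega)]
      have e6 : b.S (N - 3) = 0 := by
        rw [S, hb _ (by omega) (by omega), hb _ (by omega) (by omega)]
      by_cases h' : i ≤ N + 1
      · have : i = N - 2 ∨ i = N - 1 ∨ i = N ∨ i = N + 1 := by omega
        rcases this with rfl | rfl | rfl | rfl
        · rw [show N - 2 - 1 = N - 3 by ring, show N - 2 + 1 = N - 1 by ring]; omega
        · rw [show N - 1 - 1 = N - 2 by ring, show N - 1 + 1 = N by ring]; omega
        · omega
        · rw [show N + 1 - 1 = N by ring, show N + 1 + 1 = N + 2 by ring]; omega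
      · rw [hf.S_of_gt (by omega), hf.S_of_gt (by omega), hf.S_of_gt (by omega)]
        omega

end Config

/-- Starts from a free particle far to the right, whose level is large, and lowers that level one
unit at a time; `hρ` guarantees that the next particle of equal weight does not block a step before
ρ is reached. -/
theorem exists_content_eq_cons {k m : ℕ} {c : Config} {ρ : ℤ} (hm : 0 < m) (hmk : m ≤ k)
    (hc : c ∈ admissible k m) (hρ : ∀ x ∈ content k c, m = x.1 → x.2 ≤ ρ) :
    ∃ a ∈ admissible k m, content k a = (m, ρ) :: content k c := by
  have key : ∀ n : ℕ, ∀ a h Q, HasWeight k m a → removeFree k m a = c → IsHighest k m a h →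
      IsProfile k m a Q → min (Q h) (Q (h + 1)) = ρ + n →
        ∃ a ∈ admissible k m, content k a = (m, ρ) :: content k c := by
    intro n
    induction n with
    | zero =>
      intro a h Q hw hac hh hQ e
      refine ⟨a, hw.1, ?_⟩
      rw [content_eq_cons hw hh hQ, hac, e]
      simp
    | succ n ih =>
      intro a h Q hw hac hh hQ e
      obtain ⟨a', h', Q', hw', hac', hh', hQ', e'⟩ := hw.exists_rightMove_eq hh hQ (by
        intro h' Q' hh' hQ'
        rw [hac] at hh' hQ'
        have hwc : HasWeight k m c := ⟨hc, ⟨h', hh'.1⟩, hm, hmk⟩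
        have := hρ _ (by rw [content_eq_cons hwc hh' hQ']; exact List.mem_cons_self) rfl
        dsimp only at this
        omega)
      refine ih a' h' Q' hw' (hac'.trans hac) hh' hQ' ?_
      push_cast at e
      omega
  obtain ⟨M, hM⟩ := c.exists_forall_gt_eq_zero
  obtain ⟨Q', hQ'⟩ := IsProfile.exists_profile hmk c
  obtain ⟨J, hJ⟩ := profile_right_end_content hmk hc hQ'
  set D := ((content k c).map fun y => (phaseShift k m y.1 : ℤ)).sum
  -- A free particle at N has level Nm − D, so the second condition places it at level ρ or above.
  obtain ⟨N, hN1, hN2⟩ : ∃ N : ℤ, M + 1 + 3 ≤ N ∧ ρ + D ≤ N * m := by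
    refine ⟨max (M + 1 + 3) |ρ + D|, le_max_left _ _, ?_⟩
    calc ρ + D ≤ |ρ + D| := le_abs_self _
      _ ≤ max (M + 1 + 3) |ρ + D| := le_max_right _ _
      _ ≤ _ := le_mul_of_one_le_right ((abs_nonneg _).trans (le_max_right _ _)) (by omega)
  obtain ⟨b, hf, hw⟩ := exists_isFree hm hmk hc (M := M + 1) (fun i hi => hM i (by omega)) hN1
  obtain ⟨Q, hQ⟩ := IsProfile.exists_profile hmk b
  have e := IsProfile.level_free hmk hf hw.1 hQ hQ' (j := max J (N + 1)) (by omega)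
  rw [hJ _ (by omega)] at e
  refine key (N * m - D - ρ).toNat b N Q hw (hw.removeFree_eq (t := 0) (N := N) hf)
    (hf.isHighest hm hmk) hQ ?_
  rw [e, Int.toNat_of_nonneg (by omega)]
  ring

/-- The map `ι` is surjective. -/
theorem exists_content_eq {k l : ℕ} (hl : l ≤ k) {p : RiggedData} (hp : p ∈ riggedPartitions l) :
    ∃ a ∈ admissible k l, content k a = p := by
  induction p generalizing l with
  | nil => exact ⟨0, ⟨by simp, by simp [S], by simp [L]⟩, content_zero k⟩
  | cons x p ih =>
    obtain ⟨m, ρ⟩ := x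
    obtain ⟨h1, h2⟩ := hp
    rw [List.pairwise_cons] at h2
    obtain ⟨hm, hml⟩ := h1 _ List.mem_cons_self
    obtain ⟨c, hc, rfl⟩ := ih (l := m) (hml.trans hl)
      ⟨fun y hy => ⟨(h1 y (List.mem_cons_of_mem _ hy)).1, (h2.1 y hy).1⟩, h2.2⟩
    obtain ⟨a, ha, e⟩ := exists_content_eq_cons hm (hml.trans hl) hc fun x hx => (h2.1 x hx).2
    exact ⟨a, admissible_mono hml ha, e⟩

/-- The description of `[a, b]_l` by inequalities. -/
theorem initialImage_eq {k l a b : ℕ} (hl : l ≤ k) :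
    initialImage k l a b = {p | p ∈ riggedPartitions l ∧ HasBoundary 0 a b p} := by
  ext p
  constructor
  · rintro ⟨c, ⟨hc, hneg, rfl, rfl⟩, rfl⟩
    refine ⟨content_mem_riggedPartitions hl hc, ?_⟩
    have := content_hasBoundary (admissible_mono hl hc) hneg
    rwa [zero_add] at this
  · rintro ⟨hp, hb⟩
    obtain ⟨c, hc, rfl⟩ := exists_content_eq hl hp
    have hck := admissible_mono hl hc
    have hneg : ∀ i < 0, c i = 0 := by
      obtain ⟨z, hz⟩ := c.exists_forall_lt_eq_zero
      have key : ∀ n : ℕ, ∀ i < min 0 (z + n), c i = 0 := by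
        intro n
        induction n with
        | zero => exact fun i hi => hz i (by omega)
        | succ n ih =>
          intro i hi
          by_contra hne
          have hlow : ∀ j < i, c j = 0 := fun j hj => ih j (by omega)
          -- A leftmost occupied site i < 0 would force a rigging equal to (i + 1)λ − c_i < 0,
          -- against the bound 0.
          obtain ⟨x, hx, e⟩ := (content_hasBoundary hck hlow).2.1 (Nat.pos_of_ne_zero hne)
          have h1 := (hb.1 x hx).1
          have h2 : (i + 1) * (x.1 : ℤ) ≤ 0 :=
            mul_nonpos_of_nonpos_of_nonneg (by omega) (by omega)
          have h3 : (i + 1) * (x.1 : ℤ) = i * x.1 + x.1 := by ring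
          omega
      intro i hi
      exact key (i - z + 1).toNat i (by omega)
    have h2 := content_hasBoundary hck hneg
    obtain ⟨rfl, rfl⟩ := h2.unique hb
    rw [zero_add]
    exact ⟨c, ⟨hc, hneg, rfl, rfl⟩, rfl⟩

/-! ### Finiteness in each degree and inclusion–exclusion -/

theorem finite_setOf_list_length_le {α : Type*} {T : Set α} (hT : T.Finite) (n : ℕ) :
    {p : List α | p.length ≤ n ∧ ∀ x ∈ p, x ∈ T}.Finite := by
  induction n with
  | zero =>
    refine (Set.finite_singleton []).subset fun p hp => ?_
    exact List.length_eq_zero_iff.1 (Nat.le_zero.1 hp.1)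
  | succ n ih =>
    refine ((Set.finite_singleton []).union (hT.image2 List.cons ih)).subset fun p hp => ?_
    cases p with
    | nil => exact Or.inl rfl
    | cons x p =>
      refine Or.inr ⟨x, hp.2 x List.mem_cons_self, p, ⟨?_, fun y hy => ?_⟩, rfl⟩
      · have := hp.1
        rw [List.length_cons] at this
        omega
      · exact hp.2 y (List.mem_cons_of_mem _ hy)

theorem length_le_sum_phaseShift (k m : ℕ) (hm : 0 < m) (p : RiggedData) (hp : ∀ x ∈ p, 0 < x.1) :
    (p.length : ℤ) ≤ (p.map fun y => (phaseShift k m y.1 : ℤ)).sum := by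
  induction p with
  | nil => simp
  | cons x p ih =>
    have h1 := hp x List.mem_cons_self
    have h2 := ih fun y hy => hp y (List.mem_cons_of_mem _ hy)
    rw [List.map_cons, List.sum_cons, List.length_cons]
    have : 1 ≤ phaseShift k m x.1 := by rw [phaseShift]; omega
    push_cast
    omega

/-- The first part interacts with every later one by at least 1, which bounds the number of parts by
the degree plus one. -/
theorem riggedDegree_bounds (k : ℕ) (p : RiggedData) (hp : ∀ x ∈ p, 0 < x.1 ∧ 0 ≤ x.2) :
    0 ≤ riggedDegree k p ∧ p.length ≤ riggedDegree k p + 1 ∧ ∀ x ∈ p, x.2 ≤ riggedDegree k p := by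
  induction p with
  | nil => simp [riggedDegree]
  | cons x p ih =>
    obtain ⟨h1, h2⟩ := hp x List.mem_cons_self
    obtain ⟨i1, -, i3⟩ := ih fun y hy => hp y (List.mem_cons_of_mem _ hy)
    have h3 := length_le_sum_phaseShift k x.1 h1 p fun y hy => (hp y (List.mem_cons_of_mem _ hy)).1
    rw [riggedDegree, List.length_cons]
    refine ⟨by omega, by push_cast; omega, fun y hy => ?_⟩
    rcases List.mem_cons.1 hy with rfl | hy
    · omega
    · have := i3 y hy
      omega

theorem hasCharacter_restrictedRigged {k l : ℕ} (hl : l ≤ k) (r : List ℕ) :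
    HasCharacter k (restrictedRigged l r) := by
  have hpos : ∀ p ∈ restrictedRigged l r, ∀ x ∈ p, 0 < x.1 ∧ 0 ≤ x.2 := fun p hp x hx =>
    ⟨(hp.1.1 x hx).1, (Int.natCast_nonneg _).trans (hp.2 x hx)⟩
  refine ⟨fun p hp => ⟨fun x hx => ⟨(hp.1.1 x hx).1, (hp.1.1 x hx).2.trans hl⟩, hp.1.2⟩,
    fun p hp => (riggedDegree_bounds k p (hpos p hp)).1, fun n => ?_⟩
  refine (finite_setOf_list_length_le ((Set.finite_Icc 0 l).prod (Set.finite_Icc (0 : ℤ) n))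
    (n + 1).toNat).subset fun p ⟨hp, hd⟩ => ?_
  obtain ⟨h1, h2, h3⟩ := riggedDegree_bounds k p (hpos p hp)
  refine ⟨by omega, fun x hx => ⟨⟨Nat.zero_le _, (hp.1.1 x hx).2⟩, (hpos p hp x hx).2, ?_⟩⟩
  have := h3 x hx
  omega

theorem HasCharacter.mono {k : ℕ} {R R' : Set RiggedData} (h : HasCharacter k R) (hR : R' ⊆ R) :
    HasCharacter k R' :=
  ⟨hR.trans h.1, fun p hp => h.2.1 p (hR hp), fun n => (h.2.2 n).subset fun _ hp => ⟨hR hp.1, hp.2⟩⟩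

theorem character_empty (k : ℕ) : character k ∅ = 0 := by
  ext n
  simp [character]

theorem character_diff_union {k : ℕ} {R R₁ R₂ : Set RiggedData} (h : HasCharacter k R)
    (h₁ : R₁ ⊆ R) (h₂ : R₂ ⊆ R) : character k (R \ (R₁ ∪ R₂)) =
      character k R - character k R₁ - character k R₂ + character k (R₁ ∩ R₂) := by
  ext n
  simp only [character, map_sub, map_add, PowerSeries.coeff_mk]
  set T : Set RiggedData → Set RiggedData := fun R => {p | p ∈ R ∧ riggedDegree k p = n} with hT
  have hfin : (T R).Finite := h.2.2 n
  have hf1 : (T R₁).Finite := hfin.subset fun _ hp => ⟨h₁ hp.1, hp.2⟩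
  have hf2 : (T R₂).Finite := hfin.subset fun _ hp => ⟨h₂ hp.1, hp.2⟩
  have e1 : T (R \ (R₁ ∪ R₂)) = T R \ (T R₁ ∪ T R₂) := by
    ext p
    simp only [hT, Set.mem_ofPred_eq, Set.mem_sdiff, Set.mem_union]
    tauto
  have e2 : T (R₁ ∩ R₂) = T R₁ ∩ T R₂ := by
    ext p
    simp only [hT, Set.mem_ofPred_eq, Set.mem_inter_iff]
    tauto
  have e3 := Set.ncard_union_add_ncard_inter (T R₁) (T R₂) hf1 hf2
  have hsub : T R₁ ∪ T R₂ ⊆ T R :=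
    Set.union_subset (fun _ hp => ⟨h₁ hp.1, hp.2⟩) fun _ hp => ⟨h₂ hp.1, hp.2⟩
  have e4 := Set.ncard_sdiff_add_ncard_of_subset hsub hfin
  change ((T (R \ (R₁ ∪ R₂))).ncard : ℤ) = (T R).ncard - (T R₁).ncard - (T R₂).ncard
    + (T (R₁ ∩ R₂)).ncard
  rw [e1, e2]
  omega

/-! ### The four vectors of lower bounds and the character formula -/

theorem getD_append_eq_ite (p q : List ℕ) (i : ℕ) :
    (p ++ q).getD i 0 = if i < p.length then p.getD i 0 else q.getD (i - p.length) 0 := by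
  split_ifs with h
  · exact List.getD_append _ _ _ _ h
  · exact List.getD_append_right _ _ _ _ (not_lt.1 h)

theorem getD_range'_eq_ite (s n d i : ℕ) :
    (List.range' s n d).getD i 0 = if i < n then s + d * i else 0 := by
  split_ifs with h
  · rw [List.getD_eq_getElem?_getD, List.getElem?_range' h, Option.getD_some]
  · exact List.getD_eq_default _ _ (by rw [List.length_range']; omega)

theorem getD_replicate_zero (n i : ℕ) : (List.replicate n 0).getD i 0 = 0 := by
  rw [List.getD_eq_getElem?_getD, List.getElem?_replicate]
  split_ifs <;> rfl

theorem getD_singleton_eq_ite (x i : ℕ) : [x].getD i 0 = if i = 0 then x else 0 := by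
  cases i <;> simp

section lowerBounds
variable {l a b n : ℕ}

theorem getD_firstTerm (hn : 0 < n) (hnl : n ≤ l) :
    (((List.replicate a 0 ++ List.range' 1 b ++ List.range' (b + 2) (l - a - b) 2).getD (n - 1) 0
      : ℕ) : ℤ) = max 0 (max (n - a) (2 * n - 2 * a - b)) := by
  simp only [getD_append_eq_ite, getD_range'_eq_ite, getD_replicate_zero,
    List.length_append, List.length_replicate, List.length_range']
  split_ifs <;> omega

theorem getD_secondTerm (ha : 0 < a) (hn : 0 < n) (hnl : n ≤ l) :
    (((List.replicate (a - 1) 0 ++ [1] ++ List.range' 2 b ++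
      List.range' (b + 2) (l - a - b) 2).getD (n - 1) 0 : ℕ) : ℤ) =
        if a ≤ n ∧ n ≤ a + b then (n - a + 1 : ℤ) else max 0 (max (n - a) (2 * n - 2 * a - b)) := by
  simp only [getD_append_eq_ite, getD_range'_eq_ite, getD_replicate_zero, getD_singleton_eq_ite,
    List.length_append, List.length_replicate, List.length_range', List.length_cons,
    List.length_nil]
  split_ifs <;> omega

theorem getD_thirdTerm (hb : 0 < b) (hn : 0 < n) (hnl : n ≤ l) :
    (((List.replicate a 0 ++ List.range' 1 (b - 1) ++ [b + 1] ++
      List.range' (b + 3) (l - a - b) 2).getD (n - 1) 0 : ℕ) : ℤ) =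
        if a + b ≤ n then (2 * n - 2 * a - b + 1 : ℤ)
          else max 0 (max (n - a) (2 * n - 2 * a - b)) := by
  simp only [getD_append_eq_ite, getD_range'_eq_ite, getD_replicate_zero, getD_singleton_eq_ite,
    List.length_append, List.length_replicate, List.length_range', List.length_cons,
    List.length_nil]
  split_ifs <;> omega

theorem getD_fourthTerm (ha : 0 < a) (hb : 0 < b) (hn : 0 < n) (hnl : n ≤ l) :
    (((List.replicate (a - 1) 0 ++ [1] ++ List.range' 2 (b - 1) ++ [b + 1] ++
      List.range' (b + 3) (l - a - b) 2).getD (n - 1) 0 : ℕ) : ℤ) =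
        if a + b ≤ n then (2 * n - 2 * a - b + 1 : ℤ)
          else if a ≤ n then (n - a + 1 : ℤ) else 0 := by
  simp only [getD_append_eq_ite, getD_range'_eq_ite, getD_replicate_zero, getD_singleton_eq_ite,
    List.length_append, List.length_replicate, List.length_range', List.length_cons,
    List.length_nil]
  split_ifs <;> omega

end lowerBounds

theorem mem_restrictedRigged_iff {l : ℕ} {r : List ℕ} {f : ℕ → ℤ}
    (hf : ∀ n, 0 < n → n ≤ l → ((r.getD (n - 1) 0 : ℕ) : ℤ) = f n) (p : RiggedData) :
    p ∈ restrictedRigged l r ↔ p ∈ riggedPartitions l ∧ ∀ x ∈ p, f x.1 ≤ x.2 := by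
  refine and_congr_right fun hp => forall₂_congr fun x hx => ?_
  rw [hf x.1 (hp.1 x hx).1 (hp.1 x hx).2]

theorem character_initialImage {k l a b : ℕ} (hl : l ≤ k) :
    HasCharacter k (initialImage k l a b) ∧ character k (initialImage k l a b) =
      firstTerm k l a b - secondTerm k l a b - thirdTerm k l a b + fourthTerm k l a b := by
  set R₁ := restrictedRigged l
    (List.replicate a 0 ++ List.range' 1 b ++ List.range' (b + 2) (l - a - b) 2) with hR₁
  set R₂ : Set RiggedData := if a = 0 then ∅ else restrictedRigged l
    (List.replicate (a - 1) 0 ++ [1] ++ List.range' 2 b ++ List.range' (b + 2) (l - a - b) 2)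
    with hR₂
  set R₃ : Set RiggedData := if b = 0 then ∅ else restrictedRigged l
    (List.replicate a 0 ++ List.range' 1 (b - 1) ++ [b + 1] ++
      List.range' (b + 3) (l - a - b) 2) with hR₃
  set R₄ : Set RiggedData := if a = 0 ∨ b = 0 then ∅ else restrictedRigged l
    (List.replicate (a - 1) 0 ++ [1] ++ List.range' 2 (b - 1) ++ [b + 1] ++
      List.range' (b + 3) (l - a - b) 2) with hR₄
  have m₁ := mem_restrictedRigged_iff (l := l) (r := List.replicate a 0 ++ List.range' 1 b ++
    List.range' (b + 2) (l - a - b) 2) fun n h h' => getD_firstTerm (a := a) (b := b) h h'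
  have m₂ : ∀ p, p ∈ R₂ ↔ 0 < a ∧ p ∈ riggedPartitions l ∧ ∀ x ∈ p,
      (if a ≤ x.1 ∧ x.1 ≤ a + b then (x.1 - a + 1 : ℤ)
        else max 0 (max (x.1 - a) (2 * x.1 - 2 * a - b))) ≤ x.2 := by
    intro p
    rcases Nat.eq_zero_or_pos a with ha | ha
    · rw [hR₂, if_pos ha]
      exact ⟨False.elim, fun h => by omega⟩
    · rw [hR₂, if_neg ha.ne', mem_restrictedRigged_iff fun n h h' => getD_secondTerm ha h h']
      exact (and_iff_right ha).symm
  have m₃ : ∀ p, p ∈ R₃ ↔ 0 < b ∧ p ∈ riggedPartitions l ∧ ∀ x ∈ p,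
      (if a + b ≤ x.1 then (2 * x.1 - 2 * a - b + 1 : ℤ)
        else max 0 (max (x.1 - a) (2 * x.1 - 2 * a - b))) ≤ x.2 := by
    intro p
    rcases Nat.eq_zero_or_pos b with hb | hb
    · rw [hR₃, if_pos hb]
      exact ⟨False.elim, fun h => by omega⟩
    · rw [hR₃, if_neg hb.ne', mem_restrictedRigged_iff fun n h h' => getD_thirdTerm hb h h']
      exact (and_iff_right hb).symm
  have m₄ : ∀ p, p ∈ R₄ ↔ 0 < a ∧ 0 < b ∧ p ∈ riggedPartitions l ∧ ∀ x ∈ p,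
      (if a + b ≤ x.1 then (2 * x.1 - 2 * a - b + 1 : ℤ)
        else if a ≤ x.1 then (x.1 - a + 1 : ℤ) else 0) ≤ x.2 := by
    intro p
    rcases Nat.eq_zero_or_pos a with ha | ha
    · rw [hR₄, if_pos (Or.inl ha)]
      exact ⟨False.elim, fun h => by omega⟩
    rcases Nat.eq_zero_or_pos b with hb | hb
    · rw [hR₄, if_pos (Or.inr hb)]
      exact ⟨False.elim, fun h => by omega⟩
    · rw [hR₄, if_neg (by omega),
        mem_restrictedRigged_iff fun n h h' => getD_fourthTerm ha hb h h']
      exact ⟨fun h => ⟨ha, hb, h⟩, fun h => h.2.2⟩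
  have s₂ : R₂ ⊆ R₁ := fun p hp => by
    obtain ⟨-, h1, h2⟩ := (m₂ p).1 hp
    refine (m₁ p).2 ⟨h1, fun x hx => ?_⟩
    have := h2 x hx
    split_ifs at this <;> omega
  have s₃ : R₃ ⊆ R₁ := fun p hp => by
    obtain ⟨-, h1, h2⟩ := (m₃ p).1 hp
    refine (m₁ p).2 ⟨h1, fun x hx => ?_⟩
    have := h2 x hx
    split_ifs at this <;> omega
  have e₄ : R₂ ∩ R₃ = R₄ := by
    ext p
    rw [Set.mem_inter_iff, m₂, m₃, m₄]
    constructor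
    · rintro ⟨⟨ha, hp, h1⟩, hb, -, h2⟩
      refine ⟨ha, hb, hp, fun x hx => ?_⟩
      have := h1 x hx
      have := h2 x hx
      split_ifs at * <;> omega
    · rintro ⟨ha, hb, hp, h⟩
      refine ⟨⟨ha, hp, fun x hx => ?_⟩, hb, hp, fun x hx => ?_⟩ <;>
      · have := h x hx
        split_ifs at * <;> omega
  -- Under the bounds of R₁, a rigging can equal λ − a only if a ≤ λ ≤ a + b, and 2λ − 2a − b only
  -- if λ ≥ a + b. R₂ and R₃ raise the bounds by one exactly there, so they collect the partitions
  -- in which the respective value is not attained.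
  have e : initialImage k l a b = R₁ \ (R₂ ∪ R₃) := by
    rw [initialImage_eq hl]
    ext p
    rw [Set.mem_sdiff, Set.mem_union, m₁, m₂, m₃]
    constructor
    · rintro ⟨hp, h1, h2, h3⟩
      refine ⟨⟨hp, fun x hx => by have := h1 x hx; omega⟩, ?_⟩
      rintro (⟨ha, -, h⟩ | ⟨hb, -, h⟩)
      · obtain ⟨x, hx, e⟩ := h2 ha
        have := h1 x hx
        have := h x hx
        split_ifs at this <;> omega
      · obtain ⟨x, hx, e⟩ := h3 hb
        have := h1 x hx
        have := h x hx
        split_ifs at this <;> omega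
    · rintro ⟨⟨hp, h1⟩, h⟩
      push Not at h
      refine ⟨hp, fun x hx => by have := h1 x hx; omega, fun ha => ?_, fun hb => ?_⟩
      · obtain ⟨x, hx, hlt⟩ := h.1 ha hp
        refine ⟨x, hx, ?_⟩
        have := h1 x hx
        split_ifs at hlt <;> omega
      · obtain ⟨x, hx, hlt⟩ := h.2 hb hp
        refine ⟨x, hx, ?_⟩
        have := h1 x hx
        split_ifs at hlt <;> omega
  have h₁ := hasCharacter_restrictedRigged hl
    (List.replicate a 0 ++ List.range' 1 b ++ List.range' (b + 2) (l - a - b) 2)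
  have t₂ : secondTerm k l a b = character k R₂ := by
    rw [secondTerm, hR₂]
    split_ifs
    · exact (character_empty k).symm
    · rfl
  have t₃ : thirdTerm k l a b = character k R₃ := by
    rw [thirdTerm, hR₃]
    split_ifs
    · exact (character_empty k).symm
    · rfl
  have t₄ : fourthTerm k l a b = character k R₄ := by
    rw [fourthTerm, hR₄]
    split_ifs
    · exact (character_empty k).symm
    · rfl
  refine ⟨h₁.mono (e ▸ Set.sdiff_subset), ?_⟩
  rw [t₂, t₃, t₄, e, character_diff_union h₁ s₂ s₃, e₄]
  rfl

/-- Here b > 0 and the last blocks are empty, so for a > 0 the two vectors coincide: appending b + 1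
to 2, …, b gives the block 2, …, b + 1. -/
theorem secondTerm_eq_fourthTerm {k l a b : ℕ} (hab : a + b = l) (ha : a ≠ l) :
    secondTerm k l a b = fourthTerm k l a b := by
  rw [secondTerm, fourthTerm]
  obtain ⟨b, rfl⟩ : ∃ c, b = c + 1 := ⟨b - 1, by omega⟩
  by_cases h0 : a = 0
  · rw [if_pos h0, if_pos (Or.inl h0)]
  · rw [if_neg h0, if_neg (by omega), show l - a - (b + 1) = 0 by omega]
    congr 2
    rw [List.range'_concat]
    simp [Nat.add_comm]
    omega

/-- The empty rigged partition has degree 0 and meets every lower bound. For a = l ≥ 1 this makes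
the second term nonzero, while the fourth vanishes since b = 0. -/
theorem coeff_zero_character_restrictedRigged_ne_zero {k l : ℕ} (hl : l ≤ k) (r : List ℕ) :
    PowerSeries.coeff 0 (character k (restrictedRigged l r)) ≠ 0 := by
  have hf := (hasCharacter_restrictedRigged hl r).2.2 (0 : ℕ)
  have hmem : [] ∈ {p | p ∈ restrictedRigged l r ∧ riggedDegree k p = (0 : ℕ)} :=
    ⟨⟨⟨by simp, List.Pairwise.nil⟩, by simp⟩, rfl⟩
  have hpos := (Set.ncard_pos hf).2 ⟨_, hmem⟩
  rw [character, PowerSeries.coeff_mk]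
  exact_mod_cast hpos.ne'

theorem mainTheorem9 (k l a b : ℕ) (hlk : l ≤ k) (hab : a + b ≤ l) :
    HasCharacter k (initialImage k l a b) ∧
    (∀ r : List ℕ, r.length = l → HasCharacter k (restrictedRigged l r)) ∧
    character k (initialImage k l a b) =
      firstTerm k l a b - secondTerm k l a b - thirdTerm k l a b + fourthTerm k l a b ∧
    (a + b = l → a ≠ l → secondTerm k l a b = fourthTerm k l a b) ∧
    (a = l → 0 < l → secondTerm k l a b ≠ fourthTerm k l a b) := by
  obtain ⟨h1, h2⟩ := character_initialImage (a := a) (b := b) hlk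
  refine ⟨h1, fun r _ => hasCharacter_restrictedRigged hlk r, h2, secondTerm_eq_fourthTerm,
    fun hal hl h => ?_⟩
  have hb : b = 0 := by omega
  have h0 := coeff_zero_character_restrictedRigged_ne_zero hlk (List.replicate (a - 1) 0 ++ [1] ++
    List.range' 2 b ++ List.range' (b + 2) (l - a - b) 2)
  rw [secondTerm, fourthTerm, if_neg (by omega), if_pos (Or.inr hb)] at h
  rw [h, map_zero] at h0
  exact h0 rfl
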